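/- **Theorem (Normalization of block encodings).** Fix a hardware gate set that is closed under inverses and in which $X$, Hadamard and Toffoli have exact circuits. A circuit *implements* a unitary $V$ if, using ancilla qubits, it maps $|\psi\rangle|0\cdots0\rangle$ to $(V|\psi\rangle)|0\cdots0\rangle$. *Block encodings.* A block encoding of $x\in\mathbb C^N$ up to relative tolerance $\varepsilon\ge0$ is a tuple $(U,\Pi,\langle 0|,\gamma)$ with a unitary $U\in\mathbb C^{2^m\times 2^m}$, a matrix $\Pi\in\mathbb C^{N\times 2^m}$ with orthonormal rows and a real number $\gamma\ge|x|$ such that $|\gamma\,\Pi U|0\rangle-x|\le\varepsilon|x|$. It comes with circuits implementing $U$ and the two gates $P^\dagger P\otimes X+(\mathrm{Id}-P^\dagger P)\otimes \mathrm{Id}_2$ for $P=\Pi$ and $P=\langle0|$. Its number of gates $t(U)$ is the total number of atomic gates in these three circuits, and its information efficiency is $\eta(U)=|\Pi U|0\rangle|$. It is exact if $\varepsilon=0$. *Algorithms.* An algorithm adaptively runs circuits on $|0\cdots0\rangle$ and measures all qubits. The circuits consist of atomic gates and of calls to the circuits of the input block encoding and their inverses. The input circuits are only used as black boxes, so that the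 algorithm knows $\varepsilon,\delta,N,\gamma$ and the register sizes, but not $x$ or $\eta(U)$. Every atomic gate that is executed is counted, including those in the calls; classical computation is free. *Statement.* There is a constant $C_{\mathrm{ie}}\ge\frac14$ such that for every such gate set there are a constant $C$ and an algorithm with the following property. Let $0<\varepsilon\le1$ and $0<\delta<1$, and let $(U,\Pi,\langle0|,\gamma)$ be an exact block encoding of a vector $x\in\mathbb C^N$ with $\eta(U)>0$. Then, with probability at least $1-\delta$, the algorithm given this input halts after executing at most $$C\,\varepsilon^{-1}\,\eta(U)^{-1}\,\max\{1,\log_2\delta^{-1}\}\;t(U)$$ gates, and returns a circuit and a number $\hat\gamma$ such that the circuit implements a unitary $\hat U$, $(\hat U,\Pi,\langle0|,\hat\gamma)$ is a block encoding of $x$ up to relative tolerance $\varepsilon$, and $$\eta(\hat U)\ge C_{\mathrm{ie}},\qquad t(\hat U)\le C\,\eta(U)^{-1}\,t(U).$$ -/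

import Mathlib

open scoped Matrix Kronecker ENNReal Matrix.Norms.L2Operator

/-! ### Quantum circuits over a hardware gate set -/

/-- Computational basis labels of an `n`-qubit register; the state space is `ℂ^(2^n)`. -/
abbrev Qubits (n : ℕ) : Type := Fin n → Bool

/-- Unitary matrices on `n` qubits. -/
abbrev QUnitary (n : ℕ) : Type := Matrix.unitaryGroup (Qubits n) ℂ

/-- The atomic gates of some hardware: `gates k` is the set of available gates on `k` qubits.
With every gate its inverse is available. -/
structure GateSet where
  gates : (k : ℕ) → Set (QUnitary k)
  inv_mem : ∀ (k : ℕ) (g : QUnitary k), g ∈ gates k → g⁻¹ ∈ gates k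

/-- An embedding `e` of `k` wires into `n` wires splits the labels of the `n` wires into the
labels of the wires hit by `e` and the labels of the remaining wires. -/
noncomputable def splitQubits {k n : ℕ} (e : Fin k ↪ Fin n) :
    Qubits k × ({j : Fin n // ¬ j ∈ Set.range e} → Bool) ≃ Qubits n :=
  open Classical in
  (Equiv.prodCongr (Equiv.arrowCongr (Equiv.ofInjective e e.injective) (Equiv.refl Bool))
    (Equiv.refl _)).trans
    (Equiv.piEquivPiSubtypeProd (fun j : Fin n => j ∈ Set.range e) (fun _ => Bool)).symm

open Classical in
/-- The matrix of the gate `g` applied to the wires selected by `e` (wire `j` of the gate is wire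
`e j` of the register): `g ⊗ Id`, with `Id` acting on the other wires. -/
noncomputable def placeMatrix {k n : ℕ} (g : QUnitary k) (e : Fin k ↪ Fin n) :
    Matrix (Qubits n) (Qubits n) ℂ :=
  Matrix.reindex (splitQubits e) (splitQubits e)
    ((g : Matrix (Qubits k) (Qubits k) ℂ) ⊗ₖ
      (1 : Matrix ({j : Fin n // ¬ j ∈ Set.range e} → Bool) _ ℂ))

theorem placeMatrix_mem {k n : ℕ} (g : QUnitary k) (e : Fin k ↪ Fin n) :
    placeMatrix g e ∈ Matrix.unitaryGroup (Qubits n) ℂ := by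
  classical
  have h := Matrix.kronecker_mem_unitary g.2
    (one_mem (Matrix.unitaryGroup ({j : Fin n // ¬ j ∈ Set.range e} → Bool) ℂ))
  have h' := (Matrix.mem_unitaryGroup_iff).1 h
  rw [Matrix.mem_unitaryGroup_iff]
  unfold placeMatrix
  rw [Matrix.star_eq_conjTranspose] at h' ⊢
  rw [Matrix.conjTranspose_reindex, Matrix.reindex_apply, Matrix.reindex_apply,
    Matrix.submatrix_mul_equiv, h', Matrix.submatrix_one_equiv]

/-- Entrywise description of `placeMatrix`. -/
theorem placeMatrix_apply {k n : ℕ} (g : QUnitary k) (e : Fin k ↪ Fin n) (y b : Qubits n) :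
    placeMatrix g e y b =
      open Classical in
      if ∀ j, j ∉ Set.range e → y j = b j then
        (g : Matrix (Qubits k) (Qubits k) ℂ) (fun i => y (e i)) (fun i => b (e i))
      else 0 := by
  classical
  unfold placeMatrix
  rw [Matrix.reindex_apply, Matrix.submatrix_apply, Matrix.kronecker_apply, Matrix.one_apply]
  have h1 : ∀ z : Qubits n, ((splitQubits e).symm z).1 = fun i => z (e i) := fun z => rfl
  have h2 : ∀ z : Qubits n, ((splitQubits e).symm z).2 = fun j => z j.1 := fun z => rfl
  rw [h1, h1, h2, h2]
  have h3 : ((fun j : {j : Fin n // ¬ j ∈ Set.range e} => y j.1) = fun j => b j.1) ↔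
      ∀ j, j ∉ Set.range e → y j = b j :=
    ⟨fun h j hj => congrFun h ⟨j, hj⟩, fun h => funext fun j => h j.1 j.2⟩
  simp only [h3]
  split_ifs <;> simp

/-- A gate of the gate set together with the wires of an `n`-qubit register it acts on. -/
structure PlacedGate (𝒢 : GateSet) (n : ℕ) where
  arity : ℕ
  gate : QUnitary arity
  mem : gate ∈ 𝒢.gates arity
  wires : Fin arity ↪ Fin n

/-- A circuit on `n` qubits: a list of placed gates, the head of the list being applied first.
The number of gates of the circuit is the length of the list. -/
abbrev Circuit (𝒢 : GateSet) (n : ℕ) : Type := List (PlacedGate 𝒢 n)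

namespace PlacedGate

variable {𝒢 : GateSet} {n : ℕ}

/-- The unitary on the whole register. -/
noncomputable def eval (p : PlacedGate 𝒢 n) : QUnitary n :=
  ⟨placeMatrix p.gate p.wires, placeMatrix_mem p.gate p.wires⟩

/-- The inverse gate on the same wires. -/
noncomputable def inv (p : PlacedGate 𝒢 n) : PlacedGate 𝒢 n :=
  ⟨p.arity, p.gate⁻¹, 𝒢.inv_mem _ _ p.mem, p.wires⟩

/-- The same gate inside a larger register. -/
def lift {n' : ℕ} (e : Fin n ↪ Fin n') (p : PlacedGate 𝒢 n) : PlacedGate 𝒢 n' :=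
  ⟨p.arity, p.gate, p.mem, p.wires.trans e⟩

end PlacedGate

namespace Circuit

variable {𝒢 : GateSet} {n : ℕ}

/-- The unitary performed by a circuit. -/
noncomputable def eval : Circuit 𝒢 n → QUnitary n
  | [] => 1
  | p :: c => eval c * p.eval

/-- The circuit run backwards with inverted gates; it has the same number of gates. -/
noncomputable def inv (c : Circuit 𝒢 n) : Circuit 𝒢 n :=
  (c.map PlacedGate.inv).reverse

/-- The circuit on the wires of a larger register selected by `e`. -/
def lift {n' : ℕ} (e : Fin n ↪ Fin n') (c : Circuit 𝒢 n) : Circuit 𝒢 n' :=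
  c.map (PlacedGate.lift e)

theorem sum_normSq_eval (c : Circuit 𝒢 n) (b : Qubits n) :
    ∑ y, ENNReal.ofReal (‖(c.eval : Matrix (Qubits n) (Qubits n) ℂ) y b‖ ^ 2) = 1 := by
  have h := (Matrix.mem_unitaryGroup_iff').1 c.eval.2
  have hb := congrFun (congrFun h b) b
  rw [Matrix.mul_apply, Matrix.one_apply_eq] at hb
  simp only [Matrix.star_apply, RCLike.star_def, Complex.conj_mul'] at hb
  rw [← ENNReal.ofReal_sum_of_nonneg (fun _ _ => by positivity)]
  have : ∑ y, ‖(c.eval : Matrix (Qubits n) (Qubits n) ℂ) y b‖ ^ 2 = 1 := by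
    exact_mod_cast hb
  rw [this, ENNReal.ofReal_one]

/-- The outcome of running a circuit on `|0…0⟩` and then measuring all qubits in the computational
basis, distributed according to the Born rule. -/
noncomputable def measure (c : Circuit 𝒢 n) : PMF (Qubits n) :=
  PMF.ofFintype
    (fun y => ENNReal.ofReal
      (‖(c.eval : Matrix (Qubits n) (Qubits n) ℂ) y (fun _ => false)‖ ^ 2))
    (c.sum_normSq_eval _)

end Circuit

/-- A circuit meant to act on `n` qubits with the help of `anc` ancilla qubits. -/
structure Implementation (𝒢 : GateSet) (n : ℕ) where
  anc : ℕ
  circuit : Circuit 𝒢 (n + anc)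

namespace Implementation

variable {𝒢 : GateSet} {n : ℕ}

/-- The circuit implements the matrix `V`: it maps `|ψ⟩|0…0⟩` to `(V|ψ⟩)|0…0⟩`, i.e. the ancillas
start in the zero state and are returned to it. -/
def Implements (I : Implementation 𝒢 n) (V : Matrix (Qubits n) (Qubits n) ℂ) : Prop :=
  ∀ (b y : Qubits n) (z : Qubits I.anc),
    (I.circuit.eval : Matrix (Qubits (n + I.anc)) (Qubits (n + I.anc)) ℂ)
        (Fin.append y z) (Fin.append b (fun _ => false)) =
      if z = (fun _ => false) then V y b else 0

/-- Number of atomic gates. -/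
def gateCount (I : Implementation 𝒢 n) : ℕ := I.circuit.length

end Implementation

/-- Pauli `X`. -/
def pauliX : Matrix (Qubits 1) (Qubits 1) ℂ :=
  Matrix.of fun y b => if y 0 = !(b 0) then 1 else 0

/-- The Hadamard gate. -/
noncomputable def hadamard : Matrix (Qubits 1) (Qubits 1) ℂ :=
  Matrix.of fun y b => (if y 0 && b 0 then -1 else 1) / (Real.sqrt 2 : ℂ)

/-- The Toffoli gate: qubit 2 is flipped iff the qubits 0 and 1 are both set. -/
def toffoli : Matrix (Qubits 3) (Qubits 3) ℂ :=
  Matrix.of fun y b => if y = Function.update b 2 (xor (b 2) (b 0 && b 1)) then 1 else 0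

/-- Universality of the hardware, in the weak form that the gates `X`, `H` and Toffoli have exact
circuits. For example Clifford + T, or all one-qubit gates together with CNOT. -/
def GateSet.IsUniversal (𝒢 : GateSet) : Prop :=
  (∃ I : Implementation 𝒢 1, I.Implements pauliX) ∧
  (∃ I : Implementation 𝒢 1, I.Implements hadamard) ∧
  (∃ I : Implementation 𝒢 3, I.Implements toffoli)

/-! ### Block encodings -/

/-- The `(m+1)`-qubit gate `Π†Π ⊗ X + (Id - Π†Π) ⊗ Id₂`, the last qubit being the target. -/
def cnotProj {N m : ℕ} (P : Matrix (Fin N) (Qubits m) ℂ) :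
    Matrix (Qubits (m + 1)) (Qubits (m + 1)) ℂ :=
  Matrix.of fun y b =>
    (Pᴴ * P) (Fin.init y) (Fin.init b) * (if y (Fin.last m) = !(b (Fin.last m)) then 1 else 0) +
    (1 - Pᴴ * P : Matrix (Qubits m) (Qubits m) ℂ) (Fin.init y) (Fin.init b) *
      (if y (Fin.last m) = b (Fin.last m) then 1 else 0)

/-- The tuple `(U, Π₁, Π₂, γ)` of a block encoding of an `N₂ × N₁` matrix on `m` qubits, together
with the circuits for `U` and for the two projections (as `C_Π NOT` gates). -/
structure BlockEncoding (𝒢 : GateSet) (N₁ N₂ : ℕ) where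
  m : ℕ
  U : QUnitary m
  P₁ : Matrix (Fin N₁) (Qubits m) ℂ
  P₂ : Matrix (Fin N₂) (Qubits m) ℂ
  γ : ℝ
  orthonormal₁ : P₁ * P₁ᴴ = 1
  orthonormal₂ : P₂ * P₂ᴴ = 1
  implU : Implementation 𝒢 m
  impl₁ : Implementation 𝒢 (m + 1)
  impl₂ : Implementation 𝒢 (m + 1)
  implU_spec : implU.Implements U
  impl₁_spec : impl₁.Implements (cnotProj P₁)
  impl₂_spec : impl₂.Implements (cnotProj P₂)

namespace BlockEncoding

variable {𝒢 : GateSet} {N₁ N₂ : ℕ}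

/-- The encoded block `Π₂ U Π₁†`. -/
noncomputable def block (E : BlockEncoding 𝒢 N₁ N₂) : Matrix (Fin N₂) (Fin N₁) ℂ :=
  E.P₂ * (E.U : Matrix (Qubits E.m) (Qubits E.m) ℂ) * E.P₁ᴴ

/-- `E` is a block encoding of `S` up to relative tolerance `ε`; `‖·‖` is the operator norm with
respect to the Euclidean norms. -/
def Encodes (E : BlockEncoding 𝒢 N₁ N₂) (S : Matrix (Fin N₂) (Fin N₁) ℂ) (ε : ℝ) : Prop :=
  ‖S‖ ≤ E.γ ∧ ‖(E.γ : ℂ) • E.block - S‖ ≤ ε * ‖S‖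

/-- Information efficiency `η = |Π₂ U Π₁†|`. -/
noncomputable def efficiency (E : BlockEncoding 𝒢 N₁ N₂) : ℝ := ‖E.block‖

/-- The number `t` of atomic gates in the block encoding. -/
def gateCount (E : BlockEncoding 𝒢 N₁ N₂) : ℕ :=
  E.implU.gateCount + E.impl₁.gateCount + E.impl₂.gateCount

/-- `E` is a block encoding of the vector `x`: of `x` as a column matrix, with `Π₁ = ⟨0|`. -/
def EncodesVector {N : ℕ} (E : BlockEncoding 𝒢 1 N) (x : Fin N → ℂ) (ε : ℝ) : Prop :=
  E.P₁ = (Matrix.of fun _ b => if b = (fun _ => false) then 1 else 0) ∧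
  E.Encodes (Matrix.replicateCol (Fin 1) x) ε

/-- The block encoding with another unitary and normalization, and with the same projections. -/
def replace (E : BlockEncoding 𝒢 N₁ N₂) (V : QUnitary E.m) (I : Implementation 𝒢 E.m)
    (hI : I.Implements V) (γ' : ℝ) : BlockEncoding 𝒢 N₁ N₂ :=
  { E with U := V, γ := γ', implU := I, implU_spec := hI }

end BlockEncoding

/-! ### Algorithms with black-box access to a block encoding -/

/-- The subroutines of a block encoding. -/
inductive Subroutine where
  | U
  | proj₁
  | proj₂

/-- Register sizes of a block encoding: `m` main qubits, and the numbers of ancillas used by the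
three circuits. -/
structure Signature where
  m : ℕ
  ancU : ℕ
  anc₁ : ℕ
  anc₂ : ℕ

/-- Number of wires of a subroutine. -/
def Signature.width (s : Signature) : Subroutine → ℕ
  | .U => s.m + s.ancU
  | .proj₁ => s.m + 1 + s.anc₁
  | .proj₂ => s.m + 1 + s.anc₂

/-- One instruction of a circuit which can call subroutines: an atomic gate, or a subroutine
(or its inverse) on selected wires. -/
inductive Instruction (𝒢 : GateSet) (s : Signature) (n : ℕ) where
  | gate (p : PlacedGate 𝒢 n)
  | call (i : Subroutine) (e : Fin (s.width i) ↪ Fin n)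
  | callInv (i : Subroutine) (e : Fin (s.width i) ↪ Fin n)

/-- Circuit with subroutine calls. -/
abbrev OracleCircuit (𝒢 : GateSet) (s : Signature) (n : ℕ) : Type := List (Instruction 𝒢 s n)

/-- Replace an instruction by the atomic gates it stands for, given the circuits `O` of the
subroutines. -/
noncomputable def Instruction.expand {𝒢 : GateSet} {s : Signature} {n : ℕ}
    (O : (i : Subroutine) → Circuit 𝒢 (s.width i)) : Instruction 𝒢 s n → Circuit 𝒢 n
  | .gate p => [p]
  | .call i e => (O i).lift e
  | .callInv i e => (O i).inv.lift e

/-- Replace all subroutine calls by the circuits of the subroutines. -/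
noncomputable def OracleCircuit.expand {𝒢 : GateSet} {s : Signature} {n : ℕ}
    (O : (i : Subroutine) → Circuit 𝒢 (s.width i)) (c : OracleCircuit 𝒢 s n) : Circuit 𝒢 n :=
  c.flatMap (Instruction.expand O)

/-- The measurement outcomes seen so far. -/
abbrev History : Type := List (Σ n : ℕ, Qubits n)

/-- What the classical control does next: run a circuit on `n` qubits prepared in `|0…0⟩` and
measure them, or halt and return a circuit on `m` qubits (with ancillas) and a normalization. -/
inductive ControlAction (𝒢 : GateSet) (s : Signature) where
  | run (n : ℕ) (c : OracleCircuit 𝒢 s n)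
  | halt (anc : ℕ) (c : OracleCircuit 𝒢 s (s.m + anc)) (γ : ℝ)

/-- An adaptive procedure: the next action depends on the measurement outcomes seen so far. -/
abbrev Procedure (𝒢 : GateSet) (s : Signature) : Type := History → ControlAction 𝒢 s

/-- What is left after the procedure has halted: the number of gates that were executed, and the
returned circuit (with calls to the input) and normalization. -/
structure Result (𝒢 : GateSet) (s : Signature) where
  executed : ℕ
  anc : ℕ
  circuit : OracleCircuit 𝒢 s (s.m + anc)
  γ : ℝ

/-- State of an execution. While running: the outcomes seen so far and the gates executed. -/
inductive ExecState (𝒢 : GateSet) (s : Signature) where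
  | running (h : History) (executed : ℕ)
  | halted (r : Result 𝒢 s)

namespace Procedure

variable {𝒢 : GateSet} {s : Signature}

/-- One step of the execution, with the subroutines performed by the circuits `O`. Every gate that
is performed on the quantum computer is counted; classical control is free. -/
noncomputable def step (A : Procedure 𝒢 s) (O : (i : Subroutine) → Circuit 𝒢 (s.width i)) :
    ExecState 𝒢 s → PMF (ExecState 𝒢 s)
  | .halted r => PMF.pure (.halted r)
  | .running h t =>
    match A h with
    | .halt anc c γ => PMF.pure (.halted ⟨t, anc, c, γ⟩)
    | .run n c =>
      (c.expand O).measure.map fun y => .running (h ++ [⟨n, y⟩]) (t + (c.expand O).length)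

/-- Distribution of the state after `T` steps. -/
noncomputable def exec (A : Procedure 𝒢 s) (O : (i : Subroutine) → Circuit 𝒢 (s.width i)) :
    ℕ → PMF (ExecState 𝒢 s)
  | 0 => PMF.pure (.running [] 0)
  | T + 1 => (exec A O T).bind (A.step O)

/-- The probability that the procedure eventually halts with a result in `R` (halted states are
absorbing, so that the probabilities of having halted in `R` within `T` steps increase with `T`). -/
noncomputable def prob (A : Procedure 𝒢 s) (O : (i : Subroutine) → Circuit 𝒢 (s.width i))
    (R : Set (Result 𝒢 s)) : ℝ≥0∞ :=
  ⨆ T : ℕ, (exec A O T).toOuterMeasure {st | ∃ r ∈ R, st = .halted r}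

end Procedure

namespace BlockEncoding

variable {𝒢 : GateSet} {N₁ N₂ : ℕ}

/-- The register sizes of a block encoding. -/
def signature (E : BlockEncoding 𝒢 N₁ N₂) : Signature :=
  ⟨E.m, E.implU.anc, E.impl₁.anc, E.impl₂.anc⟩

/-- The circuits of a block encoding, as subroutines. -/
def subroutines (E : BlockEncoding 𝒢 N₁ N₂) :
    (i : Subroutine) → Circuit 𝒢 (E.signature.width i)
  | .U => E.implU.circuit
  | .proj₁ => E.impl₁.circuit
  | .proj₂ => E.impl₂.circuit

/-- The circuit returned by a procedure that was run with the block encoding `E`. -/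
noncomputable def outputImpl (E : BlockEncoding 𝒢 N₁ N₂) (r : Result 𝒢 E.signature) :
    Implementation 𝒢 E.m :=
  ⟨r.anc, r.circuit.expand E.subroutines⟩

end BlockEncoding

/-- An algorithm whose input is a tolerance `ε`, a failure probability `δ` and a block encoding of a
vector in `ℂ^N`. Of the block encoding it sees the dimension `N`, the register sizes and the
normalization factor `γ`; the circuits can only be executed and be built into other circuits, and
neither the encoded vector nor the information efficiency is known. -/
abbrev EncodingAlgorithm (𝒢 : GateSet) : Type :=
  (ε δ : ℝ) → (N : ℕ) → (s : Signature) → (γ : ℝ) → Procedure 𝒢 s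

/-!
Write `η = sin θ` for the information efficiency of the given block encoding.

*Amplification.* In the plane spanned by the components of `U|0⟩` in the range of `Π†Π` and in its
complement, `U (2|0⟩⟨0| - 1) U† (1 - 2Π†Π)` is the rotation by `2θ`. After `k` such steps, the good
component has the norm `sin ((2k+1)θ)` and still has the original direction, so that the amplified
unitary is again a block encoding of `x` (`BlockEncoding.amplified_eq`,
`BlockEncoding.amplify_block`). The reflections are obtained from the projection-controlled NOT
gates by phase kickback on a target qubit in the state `|-⟩` (`Circuit.ActsAs.reflection`), and an
additional `X` on this qubit supplies the sign. Of the elementary gates, only `X` and Hadamard are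
needed, and each step costs a bounded multiple of `t(U)` gates.

*Estimation.* For odd `M`, measuring whether the amplified state is good is a coin toss with the
success probability `sin² (Mθ)` (`BlockEncoding.measure_testCircuit`). The algorithm maintains an
odd `M` and an integer `j` with `jπ/2 ≤ Mθ ≤ (j+1)π/2`, starting from `M = 1`, `j = 0`. In each
stage, the frequency of successes in a batch determines `Mθ` within its quadrant up to `π/30`. This
suffices to multiply `M` by `3` or by `5` such that the new quadrant is known: the boundaries between
three and between five equal parts of a quadrant have distance at least `π/30` from each other
(`exists_refines`). When `j ≥ 8/ε`, the angle `θ` is known with a relative error of the order of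
`ε`, and `Mθ` is of the order of `1/ε`. This determines a number of amplification steps with
`sin ((2k+1)θ) ≥ 1/4` and a one-sided estimate of `sin θ / sin ((2k+1)θ)`, which is the factor by
which `γ` has to be changed (`SearchState.Localizes.output`).

*Failure probability and cost.* A batch of size `n` fails with probability at most a constant times
`sin² (Mθ) exp (-c n)` (`batchFail_le`). With `n` a multiple of the logarithm of
`1 / (δ ε max(j, 1))`, this is at most a small constant times `δ ε M θ`, including the stages with
`j = 0` where `Mθ` is still small; this makes a separate search for the order of magnitude of `θ`
unnecessary. Since `M` at least triples in each stage, both the failure probabilities and the costs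
`M n t(U)` are dominated by geometric sums: the former add up to at most `δ`, by the potential
`δ (1 - ε M θ / 100)` (`BlockEncoding.one_le_success_stage`), and the latter to a multiple of the
cost of the last stage (`StageInvariant`).
-/

/-! ### Semantics of circuits -/

theorem placeMatrix_one {k n : ℕ} (e : Fin k ↪ Fin n) : placeMatrix (1 : QUnitary k) e = 1 := by
  classical
  unfold placeMatrix
  rw [show ((1 : QUnitary k) : Matrix (Qubits k) (Qubits k) ℂ) = 1 from rfl,
    Matrix.one_kronecker_one, Matrix.reindex_apply, Matrix.submatrix_one_equiv]

theorem placeMatrix_mul {k n : ℕ} (g h : QUnitary k) (e : Fin k ↪ Fin n) :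
    placeMatrix (g * h) e = placeMatrix g e * placeMatrix h e := by
  classical
  unfold placeMatrix
  rw [Matrix.reindex_apply, Matrix.reindex_apply, Matrix.reindex_apply,
    Matrix.submatrix_mul_equiv, ← Matrix.mul_kronecker_mul, one_mul]
  rfl

theorem placeMatrix_placeMatrix {k n n' : ℕ} (g : QUnitary k) (w : Fin k ↪ Fin n)
    (e : Fin n ↪ Fin n') :
    placeMatrix ⟨placeMatrix g w, placeMatrix_mem g w⟩ e = placeMatrix g (w.trans e) := by
  ext y b
  rw [placeMatrix_apply, placeMatrix_apply]
  simp only [placeMatrix_apply]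
  by_cases h : ∀ j, j ∉ Set.range (w.trans e) → y j = b j
  · have h1 : ∀ j, j ∉ Set.range e → y j = b j := fun j hj =>
      h j fun ⟨i, hi⟩ => hj ⟨w i, hi⟩
    have h2 : ∀ j, j ∉ Set.range w → y (e j) = b (e j) := fun j hj =>
      h (e j) fun ⟨i, hi⟩ => hj ⟨i, e.injective hi⟩
    rw [if_pos h1, if_pos h2, if_pos h]
    rfl
  · rw [if_neg h]
    by_cases h1 : ∀ j, j ∉ Set.range e → y j = b j
    · rw [if_pos h1, if_neg]
      refine fun h2 => h fun j hj => ?_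
      by_cases hj' : j ∈ Set.range e
      · obtain ⟨i, rfl⟩ := hj'
        exact h2 i fun ⟨l, hl⟩ => hj ⟨l, by simp [hl]⟩
      · exact h1 j hj'
    · rw [if_neg h1]

namespace Circuit

variable {𝒢 : GateSet} {n : ℕ}

theorem eval_append (c d : Circuit 𝒢 n) : eval (c ++ d) = d.eval * c.eval := by
  induction c with
  | nil => simp [eval]
  | cons p c ih => simp [eval, ih, mul_assoc]

theorem eval_lift {n' : ℕ} (e : Fin n ↪ Fin n') (c : Circuit 𝒢 n) :
    ((c.lift e).eval : Matrix (Qubits n') (Qubits n') ℂ) = placeMatrix c.eval e := by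
  induction c with
  | nil => exact (placeMatrix_one e).symm
  | cons p c ih =>
    have h : ((p.lift e).eval : Matrix (Qubits n') (Qubits n') ℂ) = placeMatrix p.eval e :=
      (placeMatrix_placeMatrix p.gate p.wires e).symm
    change ((eval (Circuit.lift e c) : Matrix (Qubits n') (Qubits n') ℂ)) * (p.lift e).eval = _
    rw [ih, h, ← placeMatrix_mul]
    rfl

theorem eval_inv (c : Circuit 𝒢 n) : c.inv.eval = c.eval⁻¹ := by
  have hp : ∀ p : PlacedGate 𝒢 n, p.inv.eval = p.eval⁻¹ := fun p => by
    refine eq_inv_of_mul_eq_one_left (Subtype.ext ?_)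
    change placeMatrix p.gate⁻¹ p.wires * placeMatrix p.gate p.wires = 1
    rw [← placeMatrix_mul, inv_mul_cancel, placeMatrix_one]
  induction c with
  | nil => simp [inv, eval]
  | cons p c ih =>
    have : Circuit.inv (p :: c) = Circuit.inv c ++ [p.inv] := by simp [inv]
    rw [this, eval_append, ih]
    simp [eval, hp]

theorem length_inv (c : Circuit 𝒢 n) : c.inv.length = c.length := by simp [inv]

theorem length_lift {n' : ℕ} (e : Fin n ↪ Fin n') (c : Circuit 𝒢 n) :
    (c.lift e).length = c.length := by simp [lift]

end Circuit

namespace Implementation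

variable {𝒢 : GateSet} {k : ℕ}

/-- The circuit run backwards. -/
noncomputable def inv (I : Implementation 𝒢 k) : Implementation 𝒢 k := ⟨I.anc, I.circuit.inv⟩

theorem append_eq_append_iff {k a : ℕ} {x x' : Qubits k} {z z' : Qubits a} :
    (Fin.append x z : Qubits (k + a)) = Fin.append x' z' ↔ x = x' ∧ z = z' := by
  rw [← Prod.mk.injEq, ← (Fin.appendEquiv k a).injective.eq_iff]
  rfl

theorem Implements.inv {I : Implementation 𝒢 k} {V : QUnitary k}
    (hI : I.Implements V) : I.inv.Implements (V⁻¹ : QUnitary k) := by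
  intro b y (z : Qubits I.anc)
  set c := I.circuit.eval with hc
  -- `v` is the vector `(V⁻¹|b⟩)|0…0⟩`, which the circuit maps to `|b⟩|0…0⟩`
  let v : Qubits (k + I.anc) → ℂ := fun w =>
    ∑ x, (if w = Fin.append x (fun _ => false) then (V⁻¹).1 x b else 0)
  have hv : c.1 *ᵥ v = Pi.single (Fin.append b (fun _ => false)) 1 := by
    ext w
    obtain ⟨⟨y', z'⟩, rfl⟩ := (Fin.appendEquiv k I.anc).surjective w
    change _ = (Pi.single _ _ : Qubits (k + I.anc) → ℂ) (Fin.append y' z')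
    have : (c.1 *ᵥ v) (Fin.append y' z') =
        ∑ x, c.1 (Fin.append y' z') (Fin.append x (fun _ => false)) * (V⁻¹).1 x b := by
      simp only [Matrix.mulVec, dotProduct, v, Finset.mul_sum]
      rw [Finset.sum_comm]
      simp
    change (c.1 *ᵥ v) (Fin.append y' z') = _
    rw [this]
    simp only [hc, hI _ y' z']
    by_cases hz : z' = fun _ => false
    · subst hz
      have h1 : (V.1 * (V⁻¹).1) y' b = (1 : Matrix _ _ ℂ) y' b := by
        have := congrArg (fun W : QUnitary k => (W : Matrix (Qubits k) (Qubits k) ℂ) y' b)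
          (mul_inv_cancel V)
        exact this
      rw [Matrix.mul_apply] at h1
      simp only [if_true, h1, Matrix.one_apply, Pi.single_apply, append_eq_append_iff, and_true]
    · simp [hz, append_eq_append_iff]
  have h2 : v = (c⁻¹).1 *ᵥ Pi.single (Fin.append b (fun _ => false)) 1 := by
    rw [← hv, Matrix.mulVec_mulVec]
    have : (c⁻¹).1 * c.1 = 1 :=
      congrArg Subtype.val (inv_mul_cancel c)
    rw [this, Matrix.one_mulVec]
  have h3 := congrFun h2 (Fin.append y z)
  rw [Matrix.mulVec_single_one] at h3
  change I.circuit.inv.eval.1 (Fin.append y z) (Fin.append b fun _ => false) = _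
  rw [Circuit.eval_inv]
  refine h3.symm.trans ?_
  simp only [v, append_eq_append_iff]
  by_cases hz : z = fun _ => false
  · simp only [hz, and_true, Finset.sum_ite_eq, Finset.mem_univ, if_true]
    exact (if_pos hz).symm
  · simp only [hz, and_false, if_false, Finset.sum_const_zero]
    exact (if_neg hz).symm

open Classical in
/-- The circuit of an implementation placed into a larger register, on basis states in which its
ancillas are zero. -/
theorem Implements.lift_apply {I : Implementation 𝒢 k} {V : Matrix (Qubits k) (Qubits k) ℂ}
    (hI : I.Implements V) {n : ℕ} (e : Fin (k + I.anc) ↪ Fin n) (y b : Qubits n)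
    (hb : ∀ i, b (e (Fin.natAdd k i)) = false) :
    ((I.circuit.lift e).eval : Matrix (Qubits n) (Qubits n) ℂ) y b =
      if ∀ j, j ∉ Set.range (fun i => e (Fin.castAdd I.anc i)) → y j = b j then
        V (fun i => y (e (Fin.castAdd I.anc i))) (fun i => b (e (Fin.castAdd I.anc i)))
      else 0 := by
  rw [Circuit.eval_lift, placeMatrix_apply]
  have split : ∀ x : Qubits n, (fun i => x (e i)) =
      Fin.append (fun i => x (e (Fin.castAdd I.anc i))) (fun i => x (e (Fin.natAdd k i))) := by
    intro x
    ext i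
    refine Fin.addCases (fun i => ?_) (fun i => ?_) i <;> simp
  have hb' : (fun i => b (e i)) =
      Fin.append (fun i => b (e (Fin.castAdd I.anc i))) (fun _ => false) := by
    rw [split b]; simp only [hb]
  rw [hb', split y, hI]
  by_cases h : ∀ j, j ∉ Set.range (fun i => e (Fin.castAdd I.anc i)) → y j = b j
  · have h1 : ∀ j, j ∉ Set.range e → y j = b j := fun j hj =>
      h j fun ⟨i, hi⟩ => hj ⟨_, hi⟩
    have h2 : (fun i => y (e (Fin.natAdd k i))) = fun _ => false := by
      ext i
      rw [h (e (Fin.natAdd k i)), hb]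
      rintro ⟨l, hl⟩
      have := congrArg Fin.val (e.injective hl)
      simp at this
      omega
    rw [if_pos h, if_pos h1, if_pos h2]
  · rw [if_neg h]
    by_cases h1 : ∀ j, j ∉ Set.range e → y j = b j
    · rw [if_pos h1, if_neg]
      refine fun h2 => h fun j hj => ?_
      by_cases hj' : j ∈ Set.range e
      · obtain ⟨i, rfl⟩ := hj'
        refine Fin.addCases (fun i hj => ?_) (fun i hj => ?_) i hj
        · exact absurd ⟨i, rfl⟩ hj
        · rw [hb]; exact congrFun h2 i
      · exact h1 j hj'
    · rw [if_neg h1]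

end Implementation

/-! ### Circuits acting on the leading wires of a register with clean ancillas -/

/-- All wires from position `d` on are zero. -/
def Clean (d : ℕ) {n : ℕ} (b : Qubits n) : Prop := ∀ j : Fin n, d ≤ j.1 → b j = false

instance (d : ℕ) {n : ℕ} (b : Qubits n) : Decidable (Clean d b) :=
  inferInstanceAs (Decidable (∀ _, _))

/-- The first `d` wires. -/
def leading {d n : ℕ} (h : d ≤ n) (b : Qubits n) : Qubits d := fun i => b (Fin.castLE h i)

/-- The state of `n` wires with given first `d` wires and zeros elsewhere. -/
def padded {d : ℕ} (n : ℕ) (x : Qubits d) : Qubits n :=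
  fun j => if hj : j.1 < d then x ⟨j, hj⟩ else false

theorem clean_padded {d n : ℕ} (x : Qubits d) : Clean d (padded n x) := fun j hj => by
  simp [padded, not_lt.2 hj]

theorem leading_padded {d n : ℕ} (h : d ≤ n) (x : Qubits d) : leading h (padded n x) = x := by
  ext i; simp [leading, padded]

theorem padded_leading {d n : ℕ} (h : d ≤ n) {b : Qubits n} (hb : Clean d b) :
    padded n (leading h b) = b := by
  ext j
  by_cases hj : j.1 < d
  · simp [leading, padded, hj]
  · simp [padded, hj, hb j (not_lt.1 hj)]

theorem sum_clean {M : Type*} [AddCommMonoid M] {d n : ℕ} (h : d ≤ n) (F : Qubits n → M) :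
    ∑ w, (if Clean d w then F w else 0) = ∑ x : Qubits d, F (padded n x) := by
  rw [← Finset.sum_filter]
  refine Finset.sum_nbij' (leading h) (padded n) ?_ ?_ ?_ ?_ ?_
  · simp
  · intro x _; simp [clean_padded]
  · intro w hw; exact padded_leading h (Finset.mem_filter.1 hw).2
  · intro x _; exact leading_padded h x
  · intro w hw; rw [padded_leading h (Finset.mem_filter.1 hw).2]

namespace Circuit

variable {𝒢 : GateSet} {d n : ℕ}

/-- The circuit acts as the matrix `T` on the first `d` wires whenever the remaining wires are
zero, and it keeps the remaining wires zero. -/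
def ActsAs (h : d ≤ n) (c : Circuit 𝒢 n) (T : Matrix (Qubits d) (Qubits d) ℂ) : Prop :=
  ∀ y b : Qubits n, Clean d b → (c.eval : Matrix (Qubits n) (Qubits n) ℂ) y b =
    if Clean d y then T (leading h y) (leading h b) else 0

theorem ActsAs.nil (h : d ≤ n) : ActsAs h ([] : Circuit 𝒢 n) 1 := by
  intro y b hb
  change (1 : Matrix (Qubits n) (Qubits n) ℂ) y b = _
  by_cases hy : Clean d y
  · rw [if_pos hy, Matrix.one_apply, Matrix.one_apply]
    refine if_congr ⟨fun e => by rw [e], fun e => ?_⟩ rfl rfl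
    rw [← padded_leading h hy, e, padded_leading h hb]
  · rw [if_neg hy, Matrix.one_apply_ne]
    rintro rfl
    exact hy hb

theorem ActsAs.append {h : d ≤ n} {c₁ c₂ : Circuit 𝒢 n} {T₁ T₂ : Matrix (Qubits d) (Qubits d) ℂ}
    (h₁ : ActsAs h c₁ T₁) (h₂ : ActsAs h c₂ T₂) : ActsAs h (c₁ ++ c₂) (T₂ * T₁) := by
  intro y b hb
  rw [Circuit.eval_append]
  change ((c₂.eval : Matrix (Qubits n) (Qubits n) ℂ) * c₁.eval) y b = _
  rw [Matrix.mul_apply]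
  have : ∀ w, (c₂.eval : Matrix (Qubits n) (Qubits n) ℂ) y w *
      (c₁.eval : Matrix (Qubits n) (Qubits n) ℂ) w b = if Clean d w then
        (if Clean d y then T₂ (leading h y) (leading h w) * T₁ (leading h w) (leading h b) else 0)
        else 0 := by
    intro w
    rw [h₁ w b hb]
    by_cases hw : Clean d w
    · rw [h₂ y w hw]; simp only [hw, if_true]; split_ifs <;> simp
    · simp [hw]
  simp only [this]
  rw [sum_clean h (fun w => if Clean d y then
    T₂ (leading h y) (leading h w) * T₁ (leading h w) (leading h b) else 0)]
  simp only [leading_padded]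
  split_ifs
  · rw [Matrix.mul_apply]
  · simp

end Circuit

/-- The embedding of the wires of an implementation: the main wires go to the wires selected by
`w` among the first `d` ones, the ancillas to the wires from position `d` on. -/
def spread {k a d n : ℕ} (w : Fin k ↪ Fin d) (h : d + a ≤ n) : Fin (k + a) ↪ Fin n where
  toFun := Fin.addCases (fun i => ⟨w i, by have := (w i).2; omega⟩) (fun i => ⟨d + i, by omega⟩)
  inj' := by
    intro i j
    refine Fin.addCases (fun i => ?_) (fun i => ?_) i <;>
      refine Fin.addCases (fun j => ?_) (fun j => ?_) j <;>
      simp only [Fin.addCases_left, Fin.addCases_right, Fin.mk.injEq]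
    · intro hij; rw [w.injective (Fin.ext hij)]
    · intro hij; have := (w i).2; omega
    · intro hij; have := (w j).2; omega
    · intro hij; congr 1; ext; omega

theorem spread_castAdd {k a d n : ℕ} (w : Fin k ↪ Fin d) (h : d + a ≤ n) (i : Fin k) :
    (spread w h (Fin.castAdd a i)).1 = w i :=
  congrArg Fin.val (Fin.addCases_left (motive := fun _ => Fin n) i)

theorem spread_natAdd {k a d n : ℕ} (w : Fin k ↪ Fin d) (h : d + a ≤ n) (i : Fin a) :
    (spread w h (Fin.natAdd k i)).1 = d + i :=
  congrArg Fin.val (Fin.addCases_right (motive := fun _ => Fin n) i)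

open Classical in
/-- The matrix `V` applied to the wires selected by `w`. -/
noncomputable def onWires {k d : ℕ} (V : Matrix (Qubits k) (Qubits k) ℂ) (w : Fin k ↪ Fin d) :
    Matrix (Qubits d) (Qubits d) ℂ :=
  Matrix.of fun y b =>
    if ∀ j, j ∉ Set.range w → y j = b j then V (fun i => y (w i)) (fun i => b (w i)) else 0

theorem onWires_refl {d : ℕ} (V : Matrix (Qubits d) (Qubits d) ℂ) :
    onWires V (Function.Embedding.refl _) = V := by
  ext y b
  simp [onWires]

theorem Implementation.Implements.actsAs {𝒢 : GateSet} {k d n : ℕ} {I : Implementation 𝒢 k}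
    {V : Matrix (Qubits k) (Qubits k) ℂ} (hI : I.Implements V) (w : Fin k ↪ Fin d)
    (h : d + I.anc ≤ n) :
    Circuit.ActsAs (le_trans (Nat.le_add_right _ _) h) (I.circuit.lift (spread w h))
      (onWires V w) := by
  classical
  intro y b hb
  have hd : d ≤ n := le_trans (Nat.le_add_right _ _) h
  have hl : ∀ i, spread w h (Fin.castAdd I.anc i) = Fin.castLE hd (w i) := fun i => by
    ext; rw [spread_castAdd]; rfl
  rw [hI.lift_apply _ _ _ (fun i => hb _ (by rw [spread_natAdd]; omega))]
  simp only [hl, onWires, Matrix.of_apply, leading]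
  by_cases hy : Clean d y
  · rw [if_pos hy]
    refine if_congr ⟨fun e j hj => e _ ?_, fun e j hj => ?_⟩ rfl rfl
    · rintro ⟨i, hi⟩
      exact hj ⟨i, Fin.castLE_injective _ hi⟩
    · by_cases hj' : j.1 < d
      · refine e ⟨j, hj'⟩ ?_
        rintro ⟨i, hi⟩
        exact hj ⟨i, by ext; simp [hi]⟩
      · rw [hy j (not_lt.1 hj'), hb j (not_lt.1 hj')]
  · rw [if_neg hy, if_neg]
    refine fun e => hy fun j hj => ?_
    rw [e j, hb j hj]
    rintro ⟨i, rfl⟩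
    have := (w i).2
    simp at hj
    omega

theorem Circuit.ActsAs.implements {𝒢 : GateSet} {d a : ℕ} {c : Circuit 𝒢 (d + a)}
    {T : Matrix (Qubits d) (Qubits d) ℂ} (hc : ActsAs (Nat.le_add_right d a) c T) :
    (⟨a, c⟩ : Implementation 𝒢 d).Implements T := by
  intro b y z
  have hcl : ∀ (x : Qubits d) (z : Qubits a), Clean d (Fin.append x z) ↔ z = fun _ => false := by
    intro x z
    constructor
    · intro h; ext i; have := h (Fin.natAdd d i) (by simp); simpa using this
    · rintro rfl j
      refine Fin.addCases (fun i hi => ?_) (fun i hi => ?_) j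
      · simp at hi; omega
      · simp
  have hle : ∀ (x : Qubits d) (z : Qubits a),
      leading (Nat.le_add_right d a) (Fin.append x z) = x := fun x z => by
    funext i; exact Fin.append_left x z i
  change (c.eval : Matrix (Qubits (d + a)) (Qubits (d + a)) ℂ) _ _ = _
  rw [hc _ _ ((hcl _ _).2 rfl), hle, hle]
  exact if_congr (hcl _ _) rfl rfl

theorem Circuit.ActsAs.descend {𝒢 : GateSet} {d n : ℕ} {h : d + 1 ≤ n} {c : Circuit 𝒢 n}
    {T : Matrix (Qubits (d + 1)) (Qubits (d + 1)) ℂ} {V : Matrix (Qubits d) (Qubits d) ℂ}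
    (hc : ActsAs h c T) (hT : ∀ (x x' : Qubits d) (t : Bool),
      T (Fin.snoc x t : Qubits (d + 1)) (Fin.snoc x' false : Qubits (d + 1)) =
        if t = false then V x x' else 0) :
    ActsAs (Nat.le_of_succ_le h) c V := by
  intro y b hb
  have hs : ∀ w : Qubits n, leading h w =
      (Fin.snoc (leading (Nat.le_of_succ_le h) w) (w ⟨d, h⟩) : Qubits (d + 1)) := by
    intro w
    ext i
    refine Fin.lastCases ?_ (fun i => ?_) i
    · simp [leading]; rfl
    · simp [leading]
  rw [hc y b (fun j hj => hb j (by omega)), hs y, hs b, hb ⟨d, h⟩ le_rfl, hT]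
  by_cases hy : Clean d y
  · have h1 : Clean (d + 1) y := fun j hj => hy j (by omega)
    rw [if_pos hy, if_pos h1, if_pos (hy _ le_rfl)]
  · rw [if_neg hy]
    by_cases h1 : Clean (d + 1) y
    · rw [if_pos h1, if_neg]
      intro h2
      refine hy fun j hj => ?_
      rcases hj.eq_or_lt with hj | hj
      · have : j = ⟨d, h⟩ := Fin.ext hj.symm
        rw [this, h2]
      · exact h1 j hj
    · rw [if_neg h1]

/-! ### Reflections from projection-controlled NOT gates -/

/-- The splitting of `d + 1` qubits into the first `d` ones and the last one. -/
def lastQubitEquiv (d : ℕ) : Qubits (d + 1) ≃ Qubits d × Bool :=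
  (Fin.snocEquiv (fun _ : Fin (d + 1) => Bool)).symm.trans (Equiv.prodComm _ _)

/-- The matrix `M ⊗ B`, with `B` acting on the last qubit. -/
noncomputable def withTarget {d : ℕ} (M : Matrix (Qubits d) (Qubits d) ℂ) (B : Matrix Bool Bool ℂ) :
    Matrix (Qubits (d + 1)) (Qubits (d + 1)) ℂ :=
  (M ⊗ₖ B).submatrix (lastQubitEquiv d) (lastQubitEquiv d)

theorem withTarget_apply {d : ℕ} (M : Matrix (Qubits d) (Qubits d) ℂ) (B : Matrix Bool Bool ℂ)
    (y b : Qubits (d + 1)) :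
    withTarget M B y b = M (Fin.init y) (Fin.init b) * B (y (Fin.last d)) (b (Fin.last d)) := rfl

theorem withTarget_snoc {d : ℕ} (M : Matrix (Qubits d) (Qubits d) ℂ) (B : Matrix Bool Bool ℂ)
    (x x' : Qubits d) (t t' : Bool) :
    withTarget M B (Fin.snoc x t : Qubits (d + 1)) (Fin.snoc x' t' : Qubits (d + 1)) =
      M x x' * B t t' := by
  simp [withTarget_apply]

theorem withTarget_mul {d : ℕ} (M M' : Matrix (Qubits d) (Qubits d) ℂ) (B B' : Matrix Bool Bool ℂ) :
    withTarget M B * withTarget M' B' = withTarget (M * M') (B * B') := by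
  unfold withTarget
  rw [Matrix.submatrix_mul_equiv, Matrix.mul_kronecker_mul]

/-- Pauli `X` with labels in `Bool`. -/
def flipMatrix : Matrix Bool Bool ℂ := Matrix.of fun s t => if s = !t then 1 else 0

/-- The Hadamard gate with labels in `Bool`. -/
noncomputable def hadamardMatrix : Matrix Bool Bool ℂ :=
  Matrix.of fun s t => (if s && t then -1 else 1) / (Real.sqrt 2 : ℂ)

theorem flipMatrix_mul_self : flipMatrix * flipMatrix = 1 := by
  ext s t
  cases s <;> cases t <;> simp [flipMatrix, Matrix.mul_apply]

theorem hadamardMatrix_mul_self : hadamardMatrix * hadamardMatrix = 1 := by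
  have h : ((Real.sqrt 2 : ℝ) : ℂ) * (Real.sqrt 2 : ℝ) = 2 := by
    rw [← Complex.ofReal_mul, Real.mul_self_sqrt (by norm_num)]; norm_num
  have h2 : ((Real.sqrt 2 : ℝ) : ℂ)⁻¹ * ((Real.sqrt 2 : ℝ) : ℂ)⁻¹ = 1 / 2 := by
    rw [← mul_inv, h]; norm_num
  ext s t
  cases s <;> cases t <;> simp [hadamardMatrix, Matrix.mul_apply, neg_div, h2]
  all_goals norm_num

/-- `X` conjugated by the change of basis `|0⟩ ↦ |-⟩` is diagonal, with the phase `-1` on `|0⟩`. -/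
theorem phase_kickback :
    flipMatrix * hadamardMatrix * flipMatrix * hadamardMatrix * flipMatrix =
      Matrix.diagonal fun s => if s then 1 else -1 := by
  have h : ((Real.sqrt 2 : ℝ) : ℂ) * (Real.sqrt 2 : ℝ) = 2 := by
    rw [← Complex.ofReal_mul, Real.mul_self_sqrt (by norm_num)]; norm_num
  have h2 : ((Real.sqrt 2 : ℝ) : ℂ)⁻¹ * ((Real.sqrt 2 : ℝ) : ℂ)⁻¹ = 1 / 2 := by
    rw [← mul_inv, h]; norm_num
  ext s t
  cases s <;> cases t <;>
    simp [hadamardMatrix, flipMatrix, Matrix.mul_apply, neg_div, h2] <;> norm_num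

theorem cnotProj_eq {N d : ℕ} (P : Matrix (Fin N) (Qubits d) ℂ) :
    cnotProj P = withTarget (Pᴴ * P) flipMatrix + withTarget (1 - Pᴴ * P) 1 := by
  ext y b
  simp only [cnotProj, Matrix.of_apply, Matrix.add_apply, withTarget_apply, flipMatrix,
    Matrix.one_apply]

/-- The last of `d + 1` wires. -/
def lastWire (d : ℕ) : Fin 1 ↪ Fin (d + 1) :=
  ⟨fun _ => Fin.last d, fun _ _ _ => Subsingleton.elim _ _⟩

theorem onWires_lastWire {d : ℕ} (V : Matrix (Qubits 1) (Qubits 1) ℂ) :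
    onWires V (lastWire d) =
      withTarget 1 (Matrix.of fun s t => V (fun _ => s) (fun _ => t)) := by
  ext y b
  simp only [onWires, Matrix.of_apply, withTarget_apply, Matrix.one_apply]
  have : (∀ j, j ∉ Set.range (lastWire d) → y j = b j) ↔
      (Fin.init y : Qubits d) = (Fin.init b : Qubits d) := by
    constructor
    · intro h
      funext i
      refine h _ ?_
      rintro ⟨j, hj⟩
      exact (Fin.castSucc_lt_last i).ne hj.symm
    · intro h j
      refine Fin.lastCases (fun hj => absurd ⟨0, rfl⟩ hj) (fun i _ => congrFun h i) j
  simp only [this]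
  split_ifs
  · rw [one_mul]; rfl
  · rw [zero_mul]

theorem onWires_pauliX {d : ℕ} : onWires pauliX (lastWire d) = withTarget 1 flipMatrix :=
  onWires_lastWire _

theorem onWires_hadamard {d : ℕ} : onWires hadamard (lastWire d) = withTarget 1 hadamardMatrix :=
  onWires_lastWire _

namespace Circuit

variable {𝒢 : GateSet} {d n N : ℕ} {h : d + 1 ≤ n} {cX cH cP : Circuit 𝒢 n}

/-- With the target prepared in `|-⟩`, the gate `C_ΠNOT` performs the reflection `1 - 2Π`. -/
theorem ActsAs.reflection {P : Matrix (Fin N) (Qubits d) ℂ}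
    (hX : ActsAs h cX (withTarget 1 flipMatrix)) (hH : ActsAs h cH (withTarget 1 hadamardMatrix))
    (hP : ActsAs h cP (cnotProj P)) :
    ActsAs (Nat.le_of_succ_le h) (cX ++ (cH ++ (cP ++ (cH ++ cX)))) (1 - (2 : ℂ) • (Pᴴ * P)) := by
  refine (hX.append (hH.append (hP.append (hH.append hX)))).descend fun x x' t => ?_
  simp only [cnotProj_eq, mul_add, add_mul, withTarget_mul, one_mul, mul_one, phase_kickback,
    mul_assoc flipMatrix hadamardMatrix hadamardMatrix, hadamardMatrix_mul_self,
    flipMatrix_mul_self, Matrix.add_apply, withTarget_snoc]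
  cases t <;> simp
  ring

/-- An additional `X` on the target in the state `|-⟩` changes the sign of the reflection. -/
theorem ActsAs.neg_reflection {P : Matrix (Fin N) (Qubits d) ℂ}
    (hX : ActsAs h cX (withTarget 1 flipMatrix)) (hH : ActsAs h cH (withTarget 1 hadamardMatrix))
    (hP : ActsAs h cP (cnotProj P)) :
    ActsAs (Nat.le_of_succ_le h) (cX ++ (cH ++ (cP ++ (cX ++ (cH ++ cX)))))
      ((2 : ℂ) • (Pᴴ * P) - 1) := by
  refine (hX.append (hH.append (hP.append (hX.append (hH.append hX))))).descend fun x x' t => ?_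
  simp only [cnotProj_eq, mul_add, add_mul, withTarget_mul, one_mul, mul_one, phase_kickback,
    mul_assoc (flipMatrix * hadamardMatrix) flipMatrix flipMatrix,
    mul_assoc flipMatrix hadamardMatrix hadamardMatrix, hadamardMatrix_mul_self,
    flipMatrix_mul_self, Matrix.add_apply, withTarget_snoc]
  cases t <;> simp
  ring

end Circuit

section Unitary

variable {d N : ℕ} (P : Matrix (Fin N) (Qubits d) ℂ)

theorem proj_mul_proj (hP : P * Pᴴ = 1) : (Pᴴ * P) * (Pᴴ * P) = Pᴴ * P := by
  rw [Matrix.mul_assoc, ← Matrix.mul_assoc P, hP, Matrix.one_mul]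

theorem reflection_mem (hP : P * Pᴴ = 1) :
    1 - (2 : ℂ) • (Pᴴ * P) ∈ Matrix.unitaryGroup (Qubits d) ℂ := by
  rw [Matrix.mem_unitaryGroup_iff, Matrix.star_eq_conjTranspose]
  simp only [Matrix.conjTranspose_sub, Matrix.conjTranspose_one, Matrix.conjTranspose_smul,
    Matrix.conjTranspose_mul, Matrix.conjTranspose_conjTranspose, sub_mul, mul_sub, one_mul,
    mul_one, Matrix.smul_mul, Matrix.mul_smul, proj_mul_proj P hP, smul_smul]
  simp only [RCLike.star_def, map_ofNat]
  module

theorem neg_reflection_mem (hP : P * Pᴴ = 1) :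
    (2 : ℂ) • (Pᴴ * P) - 1 ∈ Matrix.unitaryGroup (Qubits d) ℂ := by
  have := reflection_mem P hP
  rw [Matrix.mem_unitaryGroup_iff] at this ⊢
  rw [← neg_sub, star_neg, neg_mul_neg, this]

end Unitary

/-! ### Amplitude amplification as a rotation -/

theorem l2_opNorm_sq_column {N : ℕ} (A : Matrix (Fin N) (Fin 1) ℂ) :
    ‖A‖ ^ 2 = ∑ i, ‖A i 0‖ ^ 2 := by
  have h : Aᴴ * A = Matrix.diagonal fun _ => ((∑ i, ‖A i 0‖ ^ 2 : ℝ) : ℂ) := by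
    ext i j
    rw [Subsingleton.elim i 0, Subsingleton.elim j 0, Matrix.diagonal_apply_eq, Matrix.mul_apply]
    push_cast
    refine Finset.sum_congr rfl fun l _ => ?_
    rw [Matrix.conjTranspose_apply, RCLike.star_def, Complex.conj_mul']
  rw [sq, ← Matrix.l2_opNorm_conjTranspose_mul_self, h, Matrix.l2_opNorm_diagonal, pi_norm_const,
    Complex.norm_of_nonneg (Finset.sum_nonneg fun _ _ => by positivity)]

theorem star_dotProduct_self {ι : Type*} [Fintype ι] (v : ι → ℂ) :
    star v ⬝ᵥ v = ((∑ i, ‖v i‖ ^ 2 : ℝ) : ℂ) := by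
  simp only [dotProduct, Pi.star_apply, RCLike.star_def, Complex.conj_mul']
  push_cast
  rfl

namespace BlockEncoding

variable {𝒢 : GateSet} {N : ℕ} (E : BlockEncoding 𝒢 1 N)

/-- The orthogonal projection `Π†Π` onto the subspace that carries the encoded vector. -/
noncomputable def goodProj : Matrix (Qubits E.m) (Qubits E.m) ℂ := E.P₂ᴴ * E.P₂

/-- `E.amplify k` is `(U (2|0⟩⟨0| - 1) U† (1 - 2Π†Π))ᵏ U`. -/
noncomputable def amplify : ℕ → QUnitary E.m
  | 0 => E.U
  | k + 1 => E.U * ⟨_, neg_reflection_mem E.P₁ E.orthonormal₁⟩ * E.U⁻¹ *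
      ⟨_, reflection_mem E.P₂ E.orthonormal₂⟩ * amplify k

/-- The state `E.amplify k |0…0⟩`. -/
noncomputable def amplified (k : ℕ) : Qubits E.m → ℂ :=
  (E.amplify k : Matrix (Qubits E.m) (Qubits E.m) ℂ).col fun _ => false

theorem P₂_mul_goodProj : E.P₂ * E.goodProj = E.P₂ := by
  rw [goodProj, ← Matrix.mul_assoc, E.orthonormal₂, Matrix.one_mul]

theorem goodProj_mul_self : E.goodProj * E.goodProj = E.goodProj :=
  proj_mul_proj E.P₂ E.orthonormal₂

theorem amplified_norm (k : ℕ) : star (E.amplified k) ⬝ᵥ E.amplified k = 1 := by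
  have h := (Matrix.mem_unitaryGroup_iff').1 (E.amplify k).2
  have := congrFun (congrFun h fun _ => false) fun _ => false
  rwa [Matrix.mul_apply, Matrix.one_apply_eq] at this

variable {E}
variable (hE : E.P₁ = Matrix.of fun _ b => if b = (fun _ => false) then 1 else 0)
include hE

theorem mul_P₁ {M : ℕ} (A : Matrix (Fin M) (Qubits E.m) ℂ) (i : Fin M) (j : Fin 1) :
    (A * E.P₁ᴴ) i j = A i fun _ => false := by
  rw [Matrix.mul_apply, Finset.sum_eq_single fun _ => false]
  · simp [hE]
  · intro b _ hb; simp [hE, hb]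
  · simp

theorem block_apply (i : Fin N) (j : Fin 1) : E.block i j = (E.P₂ *ᵥ E.amplified 0) i := by
  rw [block, mul_P₁ hE]
  rfl

theorem star_dotProduct_goodProj :
    star (E.amplified 0) ⬝ᵥ (E.goodProj *ᵥ E.amplified 0) = ((E.efficiency ^ 2 : ℝ) : ℂ) := by
  rw [goodProj, ← Matrix.mulVec_mulVec, Matrix.dotProduct_mulVec, ← Matrix.star_mulVec,
    star_dotProduct_self, efficiency, l2_opNorm_sq_column]
  simp only [block_apply hE]

theorem normSq_goodProj :
    ∑ y, ‖(E.goodProj *ᵥ E.amplified 0) y‖ ^ 2 = E.efficiency ^ 2 := by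
  have h : star (E.goodProj *ᵥ E.amplified 0) ⬝ᵥ (E.goodProj *ᵥ E.amplified 0) =
      ((E.efficiency ^ 2 : ℝ) : ℂ) := by
    have hh : E.goodProjᴴ = E.goodProj := by simp [goodProj]
    rw [Matrix.star_mulVec, hh, ← Matrix.dotProduct_mulVec, Matrix.mulVec_mulVec,
      goodProj_mul_self, star_dotProduct_goodProj hE]
  rw [star_dotProduct_self] at h
  exact_mod_cast h

theorem efficiency_le_one : E.efficiency ≤ 1 := by
  have hh : E.goodProjᴴ = E.goodProj := by simp [goodProj]
  have h1 := star_dotProduct_goodProj hE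
  have h : star (E.amplified 0 - E.goodProj *ᵥ E.amplified 0) ⬝ᵥ
      (E.amplified 0 - E.goodProj *ᵥ E.amplified 0) = ((1 - E.efficiency ^ 2 : ℝ) : ℂ) := by
    have h2 : star (E.goodProj *ᵥ E.amplified 0) ⬝ᵥ E.amplified 0 =
        ((E.efficiency ^ 2 : ℝ) : ℂ) := by
      rw [Matrix.star_mulVec, hh, ← Matrix.dotProduct_mulVec, h1]
    have h3 : star (E.goodProj *ᵥ E.amplified 0) ⬝ᵥ (E.goodProj *ᵥ E.amplified 0) =
        ((E.efficiency ^ 2 : ℝ) : ℂ) := by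
      rw [star_dotProduct_self, normSq_goodProj hE]
    rw [star_sub, sub_dotProduct, dotProduct_sub, dotProduct_sub, E.amplified_norm, h1, h2, h3]
    push_cast
    ring
  rw [star_dotProduct_self] at h
  have h' : ∑ i, ‖(E.amplified 0 - E.goodProj *ᵥ E.amplified 0) i‖ ^ 2 = 1 - E.efficiency ^ 2 := by
    exact_mod_cast h
  have h0 : 0 ≤ 1 - E.efficiency ^ 2 := by
    rw [← h']; exact Finset.sum_nonneg fun _ _ => by positivity
  nlinarith [norm_nonneg E.block]

/-- The reflection `U (2|0⟩⟨0| - 1) U†` at the state `U|0⟩`. -/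
theorem reflection_state (w : Qubits E.m → ℂ) :
    ((E.U : Matrix (Qubits E.m) (Qubits E.m) ℂ) * ((2 : ℂ) • (E.P₁ᴴ * E.P₁) - 1) *
      ((E.U⁻¹ : QUnitary E.m) : Matrix (Qubits E.m) (Qubits E.m) ℂ)) *ᵥ w =
      (2 * (star (E.amplified 0) ⬝ᵥ w)) • E.amplified 0 - w := by
  have h1 : ∀ u : Qubits E.m → ℂ, (E.P₁ᴴ * E.P₁) *ᵥ u =
      (u fun _ => false) • Pi.single (fun _ => false) 1 := by
    intro u
    ext y
    have : ∀ x, (E.P₁ᴴ * E.P₁) y x = if y = (fun _ => false) then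
        (if x = (fun _ => false) then 1 else 0) else 0 := by
      intro x
      rw [Matrix.mul_apply]
      simp [hE]
      split_ifs <;> simp
    simp only [Matrix.mulVec, dotProduct, this]
    by_cases hy : y = fun _ => false <;> simp [hy]
  have h2 : (E.U : Matrix (Qubits E.m) (Qubits E.m) ℂ) *
      ((E.U⁻¹ : QUnitary E.m) : Matrix (Qubits E.m) (Qubits E.m) ℂ) = 1 :=
    congrArg Subtype.val (mul_inv_cancel E.U)
  have h3 : (((E.U⁻¹ : QUnitary E.m) : Matrix (Qubits E.m) (Qubits E.m) ℂ) *ᵥ w) (fun _ => false) =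
      star (E.amplified 0) ⬝ᵥ w := rfl
  rw [← Matrix.mulVec_mulVec, ← Matrix.mulVec_mulVec, Matrix.sub_mulVec, Matrix.smul_mulVec, h1,
    h3, Matrix.one_mulVec, Matrix.mulVec_sub, Matrix.mulVec_mulVec, h2, Matrix.one_mulVec,
    Matrix.mulVec_smul, Matrix.mulVec_smul, Matrix.mulVec_single_one, smul_smul]
  rfl

/-- In the plane of the good and the bad part of `U|0⟩`, each amplification step is a rotation by
`2θ`, where `sin θ` is the information efficiency. -/
theorem amplified_eq {θ : ℝ} (hθ : Real.sin θ = E.efficiency) (k : ℕ) :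
    ∃ a b : ℝ, Real.sin θ * a = Real.sin ((2 * k + 1) * θ) ∧
      Real.cos θ * b = Real.cos ((2 * k + 1) * θ) ∧
      E.amplified k = (a : ℂ) • (E.goodProj *ᵥ E.amplified 0) +
        (b : ℂ) • (E.amplified 0 - E.goodProj *ᵥ E.amplified 0) := by
  induction k with
  | zero => exact ⟨1, 1, by simp, by simp, by simp⟩
  | succ k ih =>
    obtain ⟨a, b, ha, hb, hv⟩ := ih
    set ψ := E.amplified 0 with hψ
    set g := E.goodProj *ᵥ ψ with hg
    set D : ℝ := -a * Real.sin θ ^ 2 + b * Real.cos θ ^ 2 with hD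
    refine ⟨a + 2 * D, -b + 2 * D, ?_, ?_, ?_⟩
    · have e : (2 * ((k + 1 : ℕ) : ℝ) + 1) * θ = (2 * k + 1) * θ + 2 * θ := by push_cast; ring
      rw [e, Real.sin_add, ← ha, ← hb, Real.cos_two_mul, Real.sin_two_mul, hD]
      linear_combination (-2 * Real.sin θ * a) * Real.sin_sq_add_cos_sq θ
    · have e : (2 * ((k + 1 : ℕ) : ℝ) + 1) * θ = (2 * k + 1) * θ + 2 * θ := by push_cast; ring
      rw [e, Real.cos_add, ← ha, ← hb, Real.cos_two_mul, Real.sin_two_mul, hD]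
      ring
    · have hstep : E.amplified (k + 1) =
          ((E.U : Matrix (Qubits E.m) (Qubits E.m) ℂ) * ((2 : ℂ) • (E.P₁ᴴ * E.P₁) - 1) *
            ((E.U⁻¹ : QUnitary E.m) : Matrix (Qubits E.m) (Qubits E.m) ℂ)) *ᵥ
            ((1 - (2 : ℂ) • E.goodProj) *ᵥ E.amplified k) := by
        rw [Matrix.mulVec_mulVec]; rfl
      have hgg : E.goodProj *ᵥ g = g := by
        rw [hg, Matrix.mulVec_mulVec, goodProj_mul_self]
      have hr : (1 - (2 : ℂ) • E.goodProj) *ᵥ E.amplified k = (-a : ℂ) • g + (b : ℂ) • (ψ - g) := by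
        rw [hv, Matrix.sub_mulVec, Matrix.smul_mulVec, Matrix.one_mulVec, Matrix.mulVec_add,
          Matrix.mulVec_smul, Matrix.mulVec_smul, Matrix.mulVec_sub, ← hg, hgg]
        module
      have hd : star ψ ⬝ᵥ ((-a : ℂ) • g + (b : ℂ) • (ψ - g)) = (D : ℂ) := by
        rw [dotProduct_add, dotProduct_smul, dotProduct_smul, dotProduct_sub,
          star_dotProduct_goodProj hE, E.amplified_norm, ← hθ, hD, Real.cos_sq']
        push_cast
        simp only [smul_eq_mul]
      rw [hstep, hr, reflection_state hE, hd, ← hψ]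
      push_cast
      module

theorem goodProj_amplified {θ : ℝ} (hθ : Real.sin θ = E.efficiency) (k : ℕ) :
    ∃ a : ℝ, Real.sin θ * a = Real.sin ((2 * k + 1) * θ) ∧
      E.goodProj *ᵥ E.amplified k = (a : ℂ) • (E.goodProj *ᵥ E.amplified 0) := by
  obtain ⟨a, b, ha, -, hv⟩ := amplified_eq hE hθ k
  refine ⟨a, ha, ?_⟩
  rw [hv, Matrix.mulVec_add, Matrix.mulVec_smul, Matrix.mulVec_smul, Matrix.mulVec_sub,
    Matrix.mulVec_mulVec, goodProj_mul_self, sub_self, smul_zero, add_zero]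

theorem normSq_goodProj_amplified {θ : ℝ} (hθ : Real.sin θ = E.efficiency) (k : ℕ) :
    ∑ y, ‖(E.goodProj *ᵥ E.amplified k) y‖ ^ 2 = Real.sin ((2 * k + 1) * θ) ^ 2 := by
  obtain ⟨a, ha, hv⟩ := goodProj_amplified hE hθ k
  rw [hv, ← ha, mul_pow, hθ, ← normSq_goodProj hE, Finset.sum_mul]
  refine Finset.sum_congr rfl fun y _ => ?_
  rw [Pi.smul_apply, smul_eq_mul, norm_mul, mul_pow, Complex.norm_real, Real.norm_eq_abs, sq_abs,
    mul_comm]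

/-- The encoded block of the amplified unitary is a multiple of the original one. -/
theorem amplify_block {θ : ℝ} (hθ : Real.sin θ = E.efficiency) (k : ℕ) :
    ∃ a : ℝ, Real.sin θ * a = Real.sin ((2 * k + 1) * θ) ∧
      E.P₂ * (E.amplify k : Matrix (Qubits E.m) (Qubits E.m) ℂ) * E.P₁ᴴ = (a : ℂ) • E.block := by
  obtain ⟨a, ha, hv⟩ := goodProj_amplified hE hθ k
  refine ⟨a, ha, ?_⟩
  ext i j
  have h : (E.P₂ *ᵥ E.amplified k) = (a : ℂ) • (E.P₂ *ᵥ E.amplified 0) := by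
    rw [← P₂_mul_goodProj, ← Matrix.mulVec_mulVec, hv, Matrix.mulVec_smul, Matrix.mulVec_mulVec]
  rw [mul_P₁ hE, Matrix.smul_apply, block_apply hE]
  exact congrFun h i

end BlockEncoding

/-! ### Amplification circuits with calls to the block encoding -/

section OracleCircuits

variable {𝒢 : GateSet} (IX IH : Implementation 𝒢 1) (s : Signature)

/-- The number of ancillas, besides the target qubit, of the amplification circuits. All
subroutines and gates share the same ancillas. -/
def workspace : ℕ := s.ancU + s.anc₁ + s.anc₂ + IX.anc + IH.anc

/-- The number of wires of the amplification circuits: the main register, one target qubit and the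
shared ancillas. -/
abbrev totalWires : ℕ := s.m + (workspace IX IH s + 1)

/-- A call of `C_Π NOT` on the main register and the target qubit, for `Π = ⟨0|`. -/
def callProj₁ : OracleCircuit 𝒢 s (totalWires IX IH s) :=
  [.call .proj₁ (spread (Function.Embedding.refl (Fin (s.m + 1)))
    (show s.m + 1 + s.anc₁ ≤ _ by unfold totalWires workspace; omega))]

/-- A call of `C_Π NOT` on the main register and the target qubit, for the second projection. -/
def callProj₂ : OracleCircuit 𝒢 s (totalWires IX IH s) :=
  [.call .proj₂ (spread (Function.Embedding.refl (Fin (s.m + 1)))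
    (show s.m + 1 + s.anc₂ ≤ _ by unfold totalWires workspace; omega))]

/-- A call of `U` on the main register. -/
def callU : OracleCircuit 𝒢 s (totalWires IX IH s) :=
  [.call .U (spread (Function.Embedding.refl (Fin s.m))
    (show s.m + s.ancU ≤ _ by unfold totalWires workspace; omega))]

/-- A call of the inverse of `U` on the main register. -/
def callUInv : OracleCircuit 𝒢 s (totalWires IX IH s) :=
  [.callInv .U (spread (Function.Embedding.refl (Fin s.m))
    (show s.m + s.ancU ≤ _ by unfold totalWires workspace; omega))]

/-- The `X` gate on the target qubit. -/
def targetX : OracleCircuit 𝒢 s (totalWires IX IH s) :=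
  (IX.circuit.lift (spread (lastWire s.m)
    (show s.m + 1 + IX.anc ≤ _ by unfold totalWires workspace; omega))).map .gate

/-- The Hadamard gate on the target qubit. -/
def targetH : OracleCircuit 𝒢 s (totalWires IX IH s) :=
  (IH.circuit.lift (spread (lastWire s.m)
    (show s.m + 1 + IH.anc ≤ _ by unfold totalWires workspace; omega))).map .gate

/-- The circuit for `k` steps of amplitude amplification. -/
def amplifyCircuit : ℕ → OracleCircuit 𝒢 s (totalWires IX IH s)
  | 0 => callU IX IH s
  | k + 1 => amplifyCircuit k ++
      ((targetX IX IH s ++ (targetH IX IH s ++ (callProj₂ IX IH s ++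
        (targetH IX IH s ++ targetX IX IH s)))) ++
      (callUInv IX IH s ++
      ((targetX IX IH s ++ (targetH IX IH s ++ (callProj₁ IX IH s ++
        (targetX IX IH s ++ (targetH IX IH s ++ targetX IX IH s))))) ++ callU IX IH s)))

/-- Amplitude amplification, followed by copying to the target qubit whether the state is good. -/
def testCircuit (k : ℕ) : OracleCircuit 𝒢 s (totalWires IX IH s) :=
  amplifyCircuit IX IH s k ++ callProj₂ IX IH s

end OracleCircuits

namespace OracleCircuit

variable {𝒢 : GateSet} {s : Signature} {n : ℕ} (O : (i : Subroutine) → Circuit 𝒢 (s.width i))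

theorem expand_append (c d : OracleCircuit 𝒢 s n) :
    expand O (c ++ d) = c.expand O ++ d.expand O := List.flatMap_append

theorem expand_singleton (i : Instruction 𝒢 s n) :
    expand O [i] = i.expand O := List.append_nil _

theorem expand_gates (c : Circuit 𝒢 n) :
    expand O (c.map Instruction.gate : OracleCircuit 𝒢 s n) = c := by
  induction c with
  | nil => rfl
  | cons p c ih => exact congrArg (p :: ·) ih

end OracleCircuit

namespace BlockEncoding

variable {𝒢 : GateSet} {N : ℕ} (E : BlockEncoding 𝒢 1 N) (IX IH : Implementation 𝒢 1)

theorem le_totalWires : E.m ≤ totalWires IX IH E.signature := Nat.le_add_right _ _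

theorem succ_le_totalWires : E.m + 1 ≤ totalWires IX IH E.signature := by
  change E.m + 1 ≤ E.m + (_ + 1); omega

theorem actsAs_callProj₁ : Circuit.ActsAs (E.succ_le_totalWires IX IH)
    ((callProj₁ IX IH E.signature).expand E.subroutines) (cnotProj E.P₁) := by
  have := E.impl₁_spec.actsAs (n := totalWires IX IH E.signature) (Function.Embedding.refl _)
    (by change _ ≤ E.m + (E.implU.anc + E.impl₁.anc + E.impl₂.anc + _ + _ + 1); omega)
  rw [onWires_refl] at this
  rw [callProj₁, OracleCircuit.expand_singleton]
  exact this

theorem actsAs_callProj₂ : Circuit.ActsAs (E.succ_le_totalWires IX IH)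
    ((callProj₂ IX IH E.signature).expand E.subroutines) (cnotProj E.P₂) := by
  have := E.impl₂_spec.actsAs (n := totalWires IX IH E.signature) (Function.Embedding.refl _)
    (by change _ ≤ E.m + (E.implU.anc + E.impl₁.anc + E.impl₂.anc + _ + _ + 1); omega)
  rw [onWires_refl] at this
  rw [callProj₂, OracleCircuit.expand_singleton]
  exact this

theorem actsAs_callU : Circuit.ActsAs (E.le_totalWires IX IH)
    ((callU IX IH E.signature).expand E.subroutines) E.U := by
  have := E.implU_spec.actsAs (n := totalWires IX IH E.signature) (Function.Embedding.refl _)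
    (by change _ ≤ E.m + (E.implU.anc + E.impl₁.anc + E.impl₂.anc + _ + _ + 1); omega)
  rw [onWires_refl] at this
  rw [callU, OracleCircuit.expand_singleton]
  exact this

theorem actsAs_callUInv : Circuit.ActsAs (E.le_totalWires IX IH)
    ((callUInv IX IH E.signature).expand E.subroutines) (E.U⁻¹ : QUnitary E.m) := by
  have := E.implU_spec.inv.actsAs (n := totalWires IX IH E.signature) (Function.Embedding.refl _)
    (by change E.m + E.implU.anc ≤
          E.m + (E.implU.anc + E.impl₁.anc + E.impl₂.anc + _ + _ + 1); omega)
  rw [onWires_refl] at this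
  rw [callUInv, OracleCircuit.expand_singleton]
  exact this

variable {IX IH}

theorem actsAs_targetX (hX : IX.Implements pauliX) : Circuit.ActsAs (E.succ_le_totalWires IX IH)
    ((targetX IX IH E.signature).expand E.subroutines) (withTarget 1 flipMatrix) := by
  rw [targetX, OracleCircuit.expand_gates, ← onWires_pauliX]
  exact hX.actsAs _ _

theorem actsAs_targetH (hH : IH.Implements hadamard) :
    Circuit.ActsAs (E.succ_le_totalWires IX IH)
    ((targetH IX IH E.signature).expand E.subroutines) (withTarget 1 hadamardMatrix) := by
  rw [targetH, OracleCircuit.expand_gates, ← onWires_hadamard]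
  exact hH.actsAs _ _

theorem actsAs_amplifyCircuit (hX : IX.Implements pauliX) (hH : IH.Implements hadamard) (k : ℕ) :
    Circuit.ActsAs (E.le_totalWires IX IH)
      ((amplifyCircuit IX IH E.signature k).expand E.subroutines) (E.amplify k) := by
  induction k with
  | zero => exact E.actsAs_callU IX IH
  | succ k ih =>
    simp only [amplifyCircuit, OracleCircuit.expand_append]
    exact ih.append ((Circuit.ActsAs.reflection (E.actsAs_targetX hX) (E.actsAs_targetH hH)
      (E.actsAs_callProj₂ IX IH)).append ((E.actsAs_callUInv IX IH).append
      ((Circuit.ActsAs.neg_reflection (E.actsAs_targetX hX) (E.actsAs_targetH hH)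
        (E.actsAs_callProj₁ IX IH)).append (E.actsAs_callU IX IH))))

/-- The value of the target qubit in a measurement outcome. -/
def _root_.targetBit (m : ℕ) (z : Σ n : ℕ, Qubits n) : Bool :=
  if h : m < z.1 then z.2 ⟨m, h⟩ else false

/-- The target qubit is found in the state `1` with the probability `sin² ((2 k + 1) θ)`. -/
theorem measure_testCircuit (hX : IX.Implements pauliX) (hH : IH.Implements hadamard)
    (hE : E.P₁ = Matrix.of fun _ b => if b = (fun _ => false) then 1 else 0)
    {θ : ℝ} (hθ : Real.sin θ = E.efficiency) (k : ℕ) :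
    ∑ y, (if targetBit E.m ⟨_, y⟩ then
      ((testCircuit IX IH E.signature k).expand E.subroutines).measure y else 0) =
      ENNReal.ofReal (Real.sin ((2 * k + 1) * θ) ^ 2) := by
  have hm := E.le_totalWires IX IH
  have hm1 := E.succ_le_totalWires IX IH
  -- the amplitudes of the final state
  have key : ∀ y, (((testCircuit IX IH E.signature k).expand E.subroutines).eval :
      Matrix (Qubits (totalWires IX IH E.signature)) (Qubits (totalWires IX IH E.signature)) ℂ) y
        (fun _ => false) = if Clean (E.m + 1) y then
          ∑ x : Qubits E.m, cnotProj E.P₂ (leading hm1 y) (Fin.snoc x false : Qubits (E.m + 1)) *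
            E.amplified k x else 0 := by
    intro y
    rw [testCircuit, OracleCircuit.expand_append, Circuit.eval_append]
    rw [show ∀ V W : QUnitary (totalWires IX IH E.signature), ((V * W : QUnitary _) :
      Matrix (Qubits (totalWires IX IH E.signature)) (Qubits _) ℂ) = V.1 * W.1 from
      fun _ _ => rfl, Matrix.mul_apply]
    have h0 : Clean E.m (fun _ : Fin (totalWires IX IH E.signature) => false) := fun _ _ => rfl
    simp only [E.actsAs_amplifyCircuit hX hH k _ _ h0, mul_ite, mul_zero]
    rw [sum_clean hm]
    have h1 : ∀ x : Qubits E.m, Clean (E.m + 1) (padded (totalWires IX IH E.signature) x) :=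
      fun x j hj => clean_padded x j (by omega)
    have h2 : ∀ x : Qubits E.m, leading hm1 (padded (totalWires IX IH E.signature) x) =
        (Fin.snoc x false : Qubits (E.m + 1)) := by
      intro x
      ext i
      refine Fin.lastCases ?_ (fun i => ?_) i
      · simp [leading, padded]
      · simp [leading, padded]
    simp only [E.actsAs_callProj₂ IX IH y _ (h1 _), leading_padded, h2]
    split_ifs
    · rfl
    · simp
  have hbit : ∀ y : Qubits (totalWires IX IH E.signature),
      targetBit E.m ⟨_, y⟩ = leading hm1 y (Fin.last E.m) := fun y => by
    unfold targetBit
    rw [dif_pos (show E.m < totalWires IX IH E.signature from hm1)]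
    rfl
  have hmeas : ∀ y, (if targetBit E.m ⟨_, y⟩ then
      ((testCircuit IX IH E.signature k).expand E.subroutines).measure y else 0) =
      ENNReal.ofReal (if Clean (E.m + 1) y then (if leading hm1 y (Fin.last E.m) then
        ‖∑ x : Qubits E.m, cnotProj E.P₂ (leading hm1 y) (Fin.snoc x false : Qubits (E.m + 1)) *
            E.amplified k x‖ ^ 2 else 0) else 0) := by
    intro y
    rw [hbit, Circuit.measure, PMF.ofFintype_apply, key]
    split_ifs <;> simp
  simp only [hmeas]
  rw [← ENNReal.ofReal_sum_of_nonneg (fun _ _ => by split_ifs <;> positivity),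
    ← normSq_goodProj_amplified hE hθ k]
  congr 1
  rw [sum_clean hm1 (fun y => if leading hm1 y (Fin.last E.m) then
        ‖∑ x : Qubits E.m, cnotProj E.P₂ (leading hm1 y) (Fin.snoc x false : Qubits (E.m + 1)) *
            E.amplified k x‖ ^ 2 else 0)]
  simp only [leading_padded]
  rw [← Fintype.sum_equiv (lastQubitEquiv E.m).symm (fun p : Qubits E.m × Bool => if p.2 then
      ‖(E.goodProj *ᵥ E.amplified k) p.1‖ ^ 2 else 0), Fintype.sum_prod_type]
  · simp
  · rintro ⟨x, t⟩
    have h1 : (lastQubitEquiv E.m).symm (x, t) = (Fin.snoc x t : Qubits (E.m + 1)) := rfl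
    have h2 : (Fin.snoc x t : Qubits (E.m + 1)) (Fin.last E.m) = t := by simp
    rw [h1, h2]
    cases t
    · simp
    · simp only [if_true]
      congr 2
      simp only [cnotProj_eq, Matrix.add_apply, withTarget_snoc]
      simp [flipMatrix, Matrix.mulVec, dotProduct, goodProj]

end BlockEncoding

/-! ### Gate counts -/

namespace BlockEncoding

variable {𝒢 : GateSet} {N : ℕ} (E : BlockEncoding 𝒢 1 N) (IX IH : Implementation 𝒢 1)

/-- An upper bound, in units of the number of gates of the block encoding, for the number of gates
of one amplification step. -/
def _root_.stepCost (IX IH : Implementation 𝒢 1) : ℕ := 2 + 5 * IX.gateCount + 4 * IH.gateCount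

/-- A block encoding of a vector has at least one gate, since the flip controlled by `⟨0|` is not
the identity. -/
theorem gateCount_pos (hE : E.P₁ = Matrix.of fun _ b => if b = (fun _ => false) then 1 else 0) :
    1 ≤ E.gateCount := by
  rw [Nat.one_le_iff_ne_zero]
  intro h0
  have h1 : E.impl₁.circuit = [] := by
    unfold gateCount Implementation.gateCount at h0
    exact List.length_eq_zero_iff.1 (by omega)
  have h2 := E.impl₁_spec (Fin.snoc (fun _ => false) false : Qubits (E.m + 1))
    (Fin.snoc (fun _ => false) true : Qubits (E.m + 1)) fun _ => false
  rw [h1, if_pos rfl, cnotProj_eq, Matrix.add_apply, withTarget_snoc, withTarget_snoc] at h2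
  have h3 : (E.P₁ᴴ * E.P₁) (fun _ => false) (fun _ => false) = 1 := by
    rw [Matrix.mul_apply]; simp [hE]
  have h4 : (Fin.append (Fin.snoc (fun _ => false) true : Qubits (E.m + 1)) fun _ => false :
      Qubits (E.m + 1 + E.impl₁.anc)) ≠
      Fin.append (Fin.snoc (fun _ => false) false : Qubits (E.m + 1)) fun _ => false := by
    intro h
    have := congrFun (Implementation.append_eq_append_iff.1 h).1 (Fin.last _)
    simp at this
  have h5 : ((Circuit.eval ([] : Circuit 𝒢 (E.m + 1 + E.impl₁.anc)) :
      Matrix (Qubits (E.m + 1 + E.impl₁.anc)) (Qubits (E.m + 1 + E.impl₁.anc)) ℂ)) = 1 := rfl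
  rw [h5, Matrix.one_apply_ne h4, h3] at h2
  simp [flipMatrix] at h2

theorem length_amplifyCircuit_add (k : ℕ) :
    ((amplifyCircuit IX IH E.signature k).expand E.subroutines).length + E.impl₂.gateCount ≤
      E.gateCount + k * (2 * E.gateCount + 5 * IX.gateCount + 4 * IH.gateCount) := by
  have hU : ((callU IX IH E.signature).expand E.subroutines).length = E.implU.gateCount := by
    rw [callU, OracleCircuit.expand_singleton]; exact Circuit.length_lift _ _
  have hV : ((callUInv IX IH E.signature).expand E.subroutines).length = E.implU.gateCount := by
    rw [callUInv, OracleCircuit.expand_singleton]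
    exact (Circuit.length_lift _ _).trans (Circuit.length_inv _)
  have h1 : ((callProj₁ IX IH E.signature).expand E.subroutines).length = E.impl₁.gateCount := by
    rw [callProj₁, OracleCircuit.expand_singleton]; exact Circuit.length_lift _ _
  have h2 : ((callProj₂ IX IH E.signature).expand E.subroutines).length = E.impl₂.gateCount := by
    rw [callProj₂, OracleCircuit.expand_singleton]; exact Circuit.length_lift _ _
  have hX : ((targetX IX IH E.signature).expand E.subroutines).length = IX.gateCount := by
    rw [targetX, OracleCircuit.expand_gates]; exact Circuit.length_lift _ _
  have hH : ((targetH IX IH E.signature).expand E.subroutines).length = IH.gateCount := by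
    rw [targetH, OracleCircuit.expand_gates]; exact Circuit.length_lift _ _
  induction k with
  | zero =>
    have : amplifyCircuit IX IH E.signature 0 = callU IX IH E.signature := rfl
    rw [this, hU]
    unfold gateCount
    omega
  | succ k ih =>
    simp only [amplifyCircuit, OracleCircuit.expand_append, List.length_append, hU, hV, h1, h2, hX,
      hH]
    unfold gateCount at ih ⊢
    rw [add_mul]
    omega

theorem length_testCircuit_le
    (hE : E.P₁ = Matrix.of fun _ b => if b = (fun _ => false) then 1 else 0) (k : ℕ) :
    ((testCircuit IX IH E.signature k).expand E.subroutines).length ≤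
      (2 * k + 1) * (stepCost IX IH * E.gateCount) := by
  have h2 : ((callProj₂ IX IH E.signature).expand E.subroutines).length = E.impl₂.gateCount := by
    rw [callProj₂, OracleCircuit.expand_singleton]; exact Circuit.length_lift _ _
  rw [testCircuit, OracleCircuit.expand_append, List.length_append, h2]
  refine (E.length_amplifyCircuit_add IX IH k).trans ?_
  have h1 := E.gateCount_pos hE
  unfold stepCost
  set g := E.gateCount
  set x := IX.gateCount
  set y := IH.gateCount
  have hx : x ≤ x * g := Nat.le_mul_of_pos_right _ h1
  have hy : y ≤ y * g := Nat.le_mul_of_pos_right _ h1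
  have : k * (2 * g + 5 * x + 4 * y) ≤ k * ((2 + 5 * x + 4 * y) * g) :=
    Nat.mul_le_mul_left _ (by nlinarith)
  nlinarith [Nat.zero_le (k * ((2 + 5 * x + 4 * y) * g)), Nat.zero_le (x * g), Nat.zero_le (y * g)]

theorem length_amplifyCircuit_le
    (hE : E.P₁ = Matrix.of fun _ b => if b = (fun _ => false) then 1 else 0) (k : ℕ) :
    ((amplifyCircuit IX IH E.signature k).expand E.subroutines).length ≤
      (2 * k + 1) * (stepCost IX IH * E.gateCount) := by
  refine le_trans ?_ (E.length_testCircuit_le IX IH hE k)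
  rw [testCircuit, OracleCircuit.expand_append, List.length_append]
  exact Nat.le_add_right _ _

end BlockEncoding

/-! ### The probability of success of an adaptive procedure -/

namespace Procedure

variable {𝒢 : GateSet} {s : Signature} (A : Procedure 𝒢 s)
  (O : (i : Subroutine) → Circuit 𝒢 (s.width i)) (R : Set (Result 𝒢 s))

/-- Distribution of the state after `T` steps from a given state. -/
noncomputable def execFrom (st : ExecState 𝒢 s) : ℕ → PMF (ExecState 𝒢 s)
  | 0 => PMF.pure st
  | T + 1 => (execFrom st T).bind (A.step O)

theorem execFrom_succ (st : ExecState 𝒢 s) (T : ℕ) :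
    execFrom A O st (T + 1) = (A.step O st).bind fun st' => execFrom A O st' T := by
  induction T with
  | zero => simp [execFrom]
  | succ T ih => rw [execFrom, ih, PMF.bind_bind]; rfl

theorem exec_eq_execFrom (T : ℕ) : exec A O T = execFrom A O (.running [] 0) T := by
  induction T with
  | zero => rfl
  | succ T ih => rw [exec, execFrom, ih]

/-- The probability of having halted with a result in `R` within `T` steps. -/
noncomputable def successWithin (st : ExecState 𝒢 s) (T : ℕ) : ℝ≥0∞ :=
  (execFrom A O st T).toOuterMeasure {st | ∃ r ∈ R, st = .halted r}

/-- The probability of eventually halting with a result in `R`, from a given state. -/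
noncomputable def success (st : ExecState 𝒢 s) : ℝ≥0∞ := ⨆ T, successWithin A O R st T

theorem successWithin_succ (st : ExecState 𝒢 s) (T : ℕ) :
    successWithin A O R st (T + 1) = ∑' st', A.step O st st' * successWithin A O R st' T := by
  rw [successWithin, execFrom_succ, PMF.toOuterMeasure_bind_apply]
  rfl

theorem successWithin_halted (r : Result 𝒢 s) (T : ℕ) :
    successWithin A O R (.halted r) T = successWithin A O R (.halted r) 0 := by
  have h : execFrom A O (.halted r) T = PMF.pure (.halted r) := by
    induction T with
    | zero => rfl
    | succ T ih => rw [execFrom, ih, PMF.pure_bind]; rfl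
  rw [successWithin, h]; rfl

theorem successWithin_zero_of_running (h : History) (t : ℕ) :
    successWithin A O R (.running h t) 0 = 0 := by
  rw [successWithin, execFrom, PMF.toOuterMeasure_apply_eq_zero_iff, PMF.support_pure]
  simp

theorem successWithin_mono (st : ExecState 𝒢 s) : Monotone (successWithin A O R st) := by
  refine monotone_nat_of_le_succ fun T => ?_
  induction T generalizing st with
  | zero =>
    cases st with
    | running h t => rw [successWithin_zero_of_running]; exact zero_le
    | halted r => rw [successWithin_halted A O R r 1]
  | succ T ih =>
    rw [successWithin_succ, successWithin_succ]
    exact ENNReal.tsum_le_tsum fun st' => by gcongr; exact ih st'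

theorem success_halted {r : Result 𝒢 s} (hr : r ∈ R) : success A O R (.halted r) = 1 := by
  have h : successWithin A O R (.halted r) 0 = 1 := by
    rw [successWithin, execFrom, PMF.toOuterMeasure_apply_eq_one_iff, PMF.support_pure]
    simpa using hr
  simp only [success, successWithin_halted, h, iSup_const]

theorem success_halt {h : History} {t anc : ℕ} {c : OracleCircuit 𝒢 s (s.m + anc)} {γ : ℝ}
    (hA : A h = .halt anc c γ) (hr : ⟨t, anc, c, γ⟩ ∈ R) :
    success A O R (.running h t) = 1 := by
  have hs : A.step O (.running h t) = PMF.pure (.halted ⟨t, anc, c, γ⟩) := by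
    simp only [step, hA]
  refine le_antisymm (iSup_le fun T => ?_) ?_
  · exact ((execFrom A O _ T).toOuterMeasure.mono (Set.subset_univ _)).trans_eq
      (((PMF.toOuterMeasure_apply_eq_one_iff _ _).2 (Set.subset_univ _)))
  · rw [← success_halted A O R hr]
    refine iSup_le fun T => le_trans ?_ (le_iSup _ (T + 1))
    rw [successWithin, successWithin, execFrom_succ, hs, PMF.pure_bind]

theorem le_success_run {h : History} {t n : ℕ} {c : OracleCircuit 𝒢 s n} (hA : A h = .run n c) :
    ∑ y, (c.expand O).measure y *
      success A O R (.running (h ++ [⟨n, y⟩]) (t + (c.expand O).length)) ≤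
      success A O R (.running h t) := by
  simp only [success, ENNReal.mul_iSup]
  rw [ENNReal.finsetSum_iSup_of_monotone fun y => ?_]
  · refine iSup_le fun T => le_trans ?_ (le_iSup _ (T + 1))
    have hs : A.step O (.running h t) = (c.expand O).measure.bind fun y =>
        PMF.pure (.running (h ++ [⟨n, y⟩]) (t + (c.expand O).length)) := by
      simp only [step, hA]; rfl
    conv_rhs => rw [successWithin, execFrom_succ, hs, PMF.bind_bind,
      PMF.toOuterMeasure_bind_apply, tsum_fintype]
    simp only [PMF.pure_bind]
    rfl
  · intro T T' hT
    exact mul_le_mul_right (successWithin_mono A O R _ hT) _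

/-- One step of a supermartingale argument: if `φ b` bounds the probability of failure after the
outcome `b` of a test, and the test has the outcome `true` with the probability `p`, then the
probability of failure before the test is at most `p φ(true) + (1 - p) φ(false)`. -/
theorem one_le_success_add {h : History} {t n : ℕ} {c : OracleCircuit 𝒢 s n}
    (hA : A h = .run n c) (bit : Qubits n → Bool) {p : ℝ} (hp0 : 0 ≤ p) (hp1 : p ≤ 1)
    (hp : ∑ y, (if bit y then (c.expand O).measure y else 0) = ENNReal.ofReal p)
    {φ : Bool → ℝ} (hφ : ∀ b, 0 ≤ φ b)
    (hy : ∀ y, 1 ≤ success A O R (.running (h ++ [⟨n, y⟩]) (t + (c.expand O).length)) +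
      ENNReal.ofReal (φ (bit y))) :
    1 ≤ success A O R (.running h t) + ENNReal.ofReal (p * φ true + (1 - p) * φ false) := by
  have hsum : ∑ y, (c.expand O).measure y = 1 := by
    rw [← tsum_fintype (L := .unconditional _)]; exact (c.expand O).measure.tsum_coe
  have hq : ∑ y, (if bit y then 0 else (c.expand O).measure y) = ENNReal.ofReal (1 - p) := by
    have h2 : ∑ y, (if bit y then (c.expand O).measure y else 0) +
        ∑ y, (if bit y then 0 else (c.expand O).measure y) = 1 := by
      rw [← Finset.sum_add_distrib, ← hsum]
      exact Finset.sum_congr rfl fun y _ => by split_ifs <;> simp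
    rw [hp] at h2
    rw [ENNReal.ofReal_sub _ hp0, ENNReal.ofReal_one, ← h2,
      ENNReal.add_sub_cancel_left ENNReal.ofReal_ne_top]
  have hsplit : ∑ y, (c.expand O).measure y * ENNReal.ofReal (φ (bit y)) =
      ENNReal.ofReal (p * φ true + (1 - p) * φ false) := by
    rw [ENNReal.ofReal_add (mul_nonneg hp0 (hφ _)) (mul_nonneg (by linarith) (hφ _)),
      ENNReal.ofReal_mul hp0, ENNReal.ofReal_mul (by linarith), ← hp, ← hq, Finset.sum_mul,
      Finset.sum_mul, ← Finset.sum_add_distrib]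
    refine Finset.sum_congr rfl fun y _ => ?_
    cases bit y <;> simp
  calc (1 : ℝ≥0∞) = ∑ y, (c.expand O).measure y * 1 := by simp [hsum]
    _ ≤ ∑ y, (c.expand O).measure y *
        (success A O R (.running (h ++ [⟨n, y⟩]) (t + (c.expand O).length)) +
          ENNReal.ofReal (φ (bit y))) := Finset.sum_le_sum fun y _ => by gcongr; exact hy y
    _ ≤ _ := by
      simp only [mul_add, Finset.sum_add_distrib, hsplit]
      gcongr
      exact le_success_run A O R hA

end Procedure

/-! ### The frequency of successes in a batch of tests -/

/-- The probability that the frequency of successes in a batch of `n` independent tests with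
success probability `p` deviates from `p` by more than `τ`, if `r` tests are left and `c` successes
have been seen so far. -/
noncomputable def batchFail (p τ : ℝ) (n : ℕ) : ℕ → ℕ → ℝ
  | 0, c => if |(c : ℝ) / n - p| ≤ τ then 0 else 1
  | r + 1, c => p * batchFail p τ n r (c + 1) + (1 - p) * batchFail p τ n r c

theorem batchFail_nonneg {p τ : ℝ} (hp0 : 0 ≤ p) (hp1 : p ≤ 1) (n r c : ℕ) :
    0 ≤ batchFail p τ n r c := by
  induction r generalizing c with
  | zero => unfold batchFail; split_ifs <;> norm_num
  | succ r ih =>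
    exact add_nonneg (mul_nonneg hp0 (ih _)) (mul_nonneg (by linarith) (ih _))

/-- The exponential moment bounds of Chernoff for both tails. For the upper tail, the function
`exp (h c) - 1` instead of `exp (h c)` is used, which gives a bound proportional to `p`. -/
theorem batchFail_le_moments {p τ h : ℝ} (hp0 : 0 ≤ p) (hp1 : p ≤ 1) (hτ : 0 < τ) (hh : 0 < h)
    {n : ℕ} (hn : 0 < n) (r c : ℕ) :
    batchFail p τ n r c ≤
      (Real.exp (h * c) * (1 + p * (Real.exp h - 1)) ^ r - 1) / (Real.exp (h * (n * (p + τ))) - 1) +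
      (if p ≤ τ then 0 else
        Real.exp (-(h * c)) * (1 + p * (Real.exp (-h) - 1)) ^ r * Real.exp (h * (n * (p - τ)))) := by
  have hn' : (0 : ℝ) < n := by exact_mod_cast hn
  have hD : 0 < Real.exp (h * (n * (p + τ))) - 1 :=
    sub_pos.2 (Real.one_lt_exp_iff.2 (by positivity))
  induction r generalizing c with
  | zero =>
    have h1 : 0 ≤ (Real.exp (h * c) * (1 + p * (Real.exp h - 1)) ^ 0 - 1) /
        (Real.exp (h * (n * (p + τ))) - 1) := by
      refine div_nonneg ?_ hD.le
      rw [pow_zero, mul_one]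
      exact sub_nonneg.2 (Real.one_le_exp (by positivity))
    have h2 : 0 ≤ (if p ≤ τ then 0 else Real.exp (-(h * c)) *
        (1 + p * (Real.exp (-h) - 1)) ^ 0 * Real.exp (h * (n * (p - τ)))) := by
      split_ifs
      · exact le_rfl
      · positivity
    unfold batchFail
    split_ifs with hc hpτ hpτ
    · linarith [h1]
    · rw [if_neg hpτ] at h2; linarith
    · rw [abs_le, not_and_or, not_le, not_le] at hc
      rcases hc with hc | hc
      · exfalso
        have : (0 : ℝ) ≤ c / n := by positivity
        linarith
      · have h3 : n * (p + τ) ≤ c := by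
          have h4 : p + τ ≤ c / n := by linarith
          rwa [le_div_iff₀ hn', mul_comm] at h4
        rw [add_zero, le_div_iff₀ hD, pow_zero, mul_one, one_mul]
        gcongr
    · rw [if_neg hpτ] at h2
      rw [abs_le, not_and_or, not_le, not_le] at hc
      rcases hc with hc | hc
      · have h3 : c ≤ n * (p - τ) := by
          have h4 : c / n ≤ p - τ := by linarith
          rwa [div_le_iff₀ hn', mul_comm] at h4
        refine le_add_of_nonneg_of_le h1 ?_
        rw [pow_zero, mul_one, ← Real.exp_add]
        refine Real.one_le_exp ?_
        have := mul_le_mul_of_nonneg_left h3 hh.le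
        linarith
      · have h3 : n * (p + τ) ≤ c := by
          have h4 : p + τ ≤ c / n := by linarith
          rwa [le_div_iff₀ hn', mul_comm] at h4
        refine le_add_of_le_of_nonneg ?_ h2
        rw [le_div_iff₀ hD, pow_zero, mul_one, one_mul]
        gcongr
  | succ r ih =>
    have e1 : Real.exp (h * ((c + 1 : ℕ) : ℝ)) = Real.exp (h * c) * Real.exp h := by
      rw [← Real.exp_add]; congr 1; push_cast; ring
    have e2 : Real.exp (-(h * ((c + 1 : ℕ) : ℝ))) = Real.exp (-(h * c)) * Real.exp (-h) := by
      rw [← Real.exp_add]; congr 1; push_cast; ring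
    have i1 := mul_le_mul_of_nonneg_left (ih (c + 1)) hp0
    have i2 := mul_le_mul_of_nonneg_left (ih c) (show 0 ≤ 1 - p by linarith)
    rw [e1, e2] at i1
    unfold batchFail
    refine (add_le_add i1 i2).trans_eq ?_
    split_ifs
    · field_simp; ring
    · field_simp; ring

theorem exp_le_one_add_add_sq {x : ℝ} (hx : |x| ≤ 1) : Real.exp x ≤ 1 + x + x ^ 2 := by
  have := (abs_le.1 (Real.abs_exp_sub_one_sub_id_le hx)).2
  linarith

/-- The probability that the frequency in a batch deviates by more than `τ` is exponentially small
in the size of the batch and, at the same time, proportional to `p`. -/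
theorem batchFail_le {p τ : ℝ} (hp0 : 0 ≤ p) (hp1 : p ≤ 1) (hτ : 0 < τ) (hτ1 : τ ≤ 1) {n : ℕ}
    (hn : 2 / τ ^ 2 ≤ n) :
    batchFail p τ n n 0 ≤ 17 / τ * p * Real.exp (-(n * τ ^ 2 / 8)) := by
  have hn' : (0 : ℝ) < n := lt_of_lt_of_le (by positivity) hn
  have hn0 : 0 < n := by exact_mod_cast hn'
  have hnτ : 2 ≤ n * τ ^ 2 := by rwa [div_le_iff₀ (by positivity)] at hn
  set h := τ / 2 with hh
  have hh0 : 0 < h := by positivity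
  refine (batchFail_le_moments hp0 hp1 hτ hh0 hn0 n 0).trans ?_
  rw [Nat.cast_zero, mul_zero, neg_zero, Real.exp_zero, one_mul, one_mul]
  have hE : Real.exp h ≤ 1 + h + h ^ 2 := exp_le_one_add_add_sq (by rw [abs_of_pos hh0]; linarith)
  have hE' : Real.exp (-h) ≤ 1 - h + h ^ 2 := by
    have := exp_le_one_add_add_sq (x := -h) (by rw [abs_neg, abs_of_pos hh0]; linarith)
    linarith [this, neg_sq h]
  have hE1 : 1 ≤ Real.exp h := Real.one_le_exp hh0.le
  set e := Real.exp (-(n * τ ^ 2 / 4)) with he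
  have hee : e ≤ Real.exp (-(n * τ ^ 2 / 8)) := Real.exp_le_exp.2 (by nlinarith)
  -- the upper tail
  have up : ((1 + p * (Real.exp h - 1)) ^ n - 1) / (Real.exp (h * (n * (p + τ))) - 1) ≤
      16 / τ * p * Real.exp (-(n * τ ^ 2 / 8)) := by
    set x := p * (Real.exp h - 1) with hx
    have hx0 : 0 ≤ x := mul_nonneg hp0 (by linarith)
    have hx1 : x ≤ p * (h + h ^ 2) := mul_le_mul_of_nonneg_left (by linarith) hp0
    have a1 : (1 + x) ^ n ≤ Real.exp (n * x) := by
      rw [Real.exp_nat_mul]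
      exact pow_le_pow_left₀ (by linarith) (by linarith [Real.add_one_le_exp x]) n
    have a2 : Real.exp (n * x) - 1 ≤ n * x * Real.exp (n * x) := by
      have : 1 - n * x ≤ Real.exp (-(n * x)) := by linarith [Real.add_one_le_exp (-(n * x))]
      have h2 := mul_le_mul_of_nonneg_right this (Real.exp_pos (n * x)).le
      rw [← Real.exp_add, neg_add_cancel, Real.exp_zero] at h2
      linarith
    have a3 : 2 ≤ Real.exp (h * (n * (p + τ))) := by
      have : 1 ≤ h * (n * (p + τ)) := by
        have h1 : 0 ≤ h * (n * p) := by positivity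
        have h2 : h * (n * τ) = n * τ ^ 2 / 2 := by rw [hh]; ring
        nlinarith
      linarith [Real.add_one_le_exp (h * (n * (p + τ)))]
    have a4 : Real.exp (h * (n * (p + τ))) / 2 ≤ Real.exp (h * (n * (p + τ))) - 1 := by linarith
    have a5 : Real.exp (n * x) ≤ e * Real.exp (h * (n * (p + τ))) := by
      rw [he, ← Real.exp_add, Real.exp_le_exp]
      have h1 : n * x ≤ n * (p * (h + h ^ 2)) := mul_le_mul_of_nonneg_left hx1 hn'.le
      have h2 : n * (p * h ^ 2) ≤ n * (1 * h ^ 2) := by gcongr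
      have h3 : h * (n * (p + τ)) = n * (p * h) + n * τ ^ 2 / 2 := by rw [hh]; ring
      have h4 : n * (1 * h ^ 2) = n * τ ^ 2 / 4 := by rw [hh]; ring
      nlinarith
    have a6 : n * x ≤ n * τ * p := by
      have : h ^ 2 ≤ h := by nlinarith
      have h2 : x ≤ p * τ := hx1.trans (mul_le_mul_of_nonneg_left (by linarith) hp0)
      nlinarith
    have a7 : n * τ ^ 2 / 8 * e ≤ Real.exp (-(n * τ ^ 2 / 8)) := by
      have h1 : e = Real.exp (-(n * τ ^ 2 / 8)) * Real.exp (-(n * τ ^ 2 / 8)) := by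
        rw [he, ← Real.exp_add]; congr 1; ring
      have h2 : n * τ ^ 2 / 8 * Real.exp (-(n * τ ^ 2 / 8)) ≤ 1 := by
        have := mul_le_mul_of_nonneg_right
          (show n * τ ^ 2 / 8 ≤ Real.exp (n * τ ^ 2 / 8) by
            linarith [Real.add_one_le_exp (n * τ ^ 2 / 8)])
          (Real.exp_pos (-(n * τ ^ 2 / 8))).le
        rwa [← Real.exp_add, add_neg_cancel, Real.exp_zero] at this
      rw [h1, ← mul_assoc]
      exact mul_le_of_le_one_left (Real.exp_pos _).le h2
    have hD : 0 < Real.exp (h * (n * (p + τ))) := Real.exp_pos _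
    rw [div_le_iff₀ (by linarith)]
    calc (1 + x) ^ n - 1 ≤ n * x * Real.exp (n * x) := by linarith
      _ ≤ n * τ * p * (e * Real.exp (h * (n * (p + τ)))) := by gcongr
      _ = 16 / τ * p * (n * τ ^ 2 / 8 * e) * (Real.exp (h * (n * (p + τ))) / 2) := by
        field_simp; ring
      _ ≤ 16 / τ * p * Real.exp (-(n * τ ^ 2 / 8)) * (Real.exp (h * (n * (p + τ))) - 1) := by
        gcongr
  -- the lower tail, which is empty for `p ≤ τ`
  have low : (if p ≤ τ then 0 else
      (1 + p * (Real.exp (-h) - 1)) ^ n * Real.exp (h * (n * (p - τ)))) ≤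
      1 / τ * p * Real.exp (-(n * τ ^ 2 / 8)) := by
    split_ifs with hpτ
    · positivity
    · push Not at hpτ
      have b0 : 0 ≤ 1 + p * (Real.exp (-h) - 1) := by nlinarith [Real.exp_pos (-h)]
      have b1 : (1 + p * (Real.exp (-h) - 1)) ^ n ≤ Real.exp (n * (p * (Real.exp (-h) - 1))) := by
        rw [Real.exp_nat_mul]
        exact pow_le_pow_left₀ b0 (by linarith [Real.add_one_le_exp (p * (Real.exp (-h) - 1))]) n
      have b2 : (1 + p * (Real.exp (-h) - 1)) ^ n * Real.exp (h * (n * (p - τ))) ≤ e := by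
        refine (mul_le_mul_of_nonneg_right b1 (Real.exp_pos _).le).trans ?_
        rw [he, ← Real.exp_add, Real.exp_le_exp]
        have h1 : p * (Real.exp (-h) - 1) ≤ p * (-h + h ^ 2) :=
          mul_le_mul_of_nonneg_left (by linarith) hp0
        have h1' := mul_le_mul_of_nonneg_left h1 hn'.le
        have h2 : n * (p * h ^ 2) ≤ n * (1 * h ^ 2) := by gcongr
        have h3 : h * (n * (p - τ)) = n * (p * h) - n * τ ^ 2 / 2 := by rw [hh]; ring
        have h4 : n * (1 * h ^ 2) = n * τ ^ 2 / 4 := by rw [hh]; ring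
        nlinarith
      have b3 : 1 ≤ 1 / τ * p := by rw [one_div, inv_mul_eq_div, one_le_div hτ]; exact hpτ.le
      calc _ ≤ e := b2
        _ ≤ Real.exp (-(n * τ ^ 2 / 8)) := hee
        _ ≤ _ := le_mul_of_one_le_left (Real.exp_pos _).le b3
  refine (add_le_add up low).trans_eq ?_
  ring

/-! ### Refining the estimate of an angle -/

open Real in
/-- The admissible deviation of the frequency of successes in a batch. -/
noncomputable def tolerance : ℝ := sin (π / 30) ^ 2 / 2

theorem tolerance_pos : 0 < tolerance := by
  have := Real.sin_pos_of_pos_of_lt_pi (x := Real.pi / 30) (by positivity)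
    (by linarith [Real.pi_pos])
  unfold tolerance
  positivity

theorem tolerance_le_one : tolerance ≤ 1 := by
  unfold tolerance
  nlinarith [Real.sin_sq_le_one (Real.pi / 30)]

theorem sin_sq_sub_le {a b : ℝ} (hb : 0 ≤ b) (hab : b ≤ a) (ha : a ≤ Real.pi / 2) :
    Real.sin (a - b) ^ 2 ≤ Real.sin a ^ 2 - Real.sin b ^ 2 := by
  have h1 : Real.sin a ^ 2 - Real.sin b ^ 2 = Real.sin (a + b) * Real.sin (a - b) := by
    rw [Real.sin_add, Real.sin_sub]
    linear_combination Real.sin a ^ 2 * (Real.sin_sq_add_cos_sq b).symm -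
      Real.sin b ^ 2 * (Real.sin_sq_add_cos_sq a).symm
  have h2 : Real.sin (a - b) ≤ Real.sin (a + b) := by
    have h3 := Real.cos_nonneg_of_mem_Icc (x := a) ⟨by linarith, ha⟩
    have h4 := Real.sin_nonneg_of_nonneg_of_le_pi (x := b) hb (by linarith)
    rw [Real.sin_add, Real.sin_sub]
    nlinarith [mul_nonneg h3 h4]
  have h5 := Real.sin_nonneg_of_nonneg_of_le_pi (x := a - b) (by linarith) (by linarith)
  rw [h1, sq]
  exact mul_le_mul_of_nonneg_right h2 h5

theorem abs_sin_sq_quadrant (j : ℕ) (a b : ℝ) :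
    |Real.sin (j * Real.pi / 2 + a) ^ 2 - Real.sin (j * Real.pi / 2 + b) ^ 2| =
      |Real.sin a ^ 2 - Real.sin b ^ 2| := by
  rcases Nat.even_or_odd' j with ⟨i, rfl | rfl⟩
  · have : ∀ x : ℝ, Real.sin (((2 * i : ℕ) : ℝ) * Real.pi / 2 + x) ^ 2 = Real.sin x ^ 2 := fun x => by
      rw [show ((2 * i : ℕ) : ℝ) * Real.pi / 2 + x = x + i * Real.pi by push_cast; ring,
        Real.sin_add_nat_mul_pi, mul_pow, ← pow_mul, mul_comm i 2, pow_mul]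
      simp
    rw [this, this]
  · have : ∀ x : ℝ, Real.sin (((2 * i + 1 : ℕ) : ℝ) * Real.pi / 2 + x) ^ 2 = 1 - Real.sin x ^ 2 :=
      fun x => by
      rw [show ((2 * i + 1 : ℕ) : ℝ) * Real.pi / 2 + x = x + Real.pi / 2 + i * Real.pi by
        push_cast; ring, Real.sin_add_nat_mul_pi, mul_pow, ← pow_mul, mul_comm i 2, pow_mul,
        Real.sin_add_pi_div_two, Real.cos_sq']
      simp
    rw [this, this, abs_sub_comm]
    congr 1
    ring

/-- Remainders in a quadrant which are compatible with the same frequency are close. -/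
theorem abs_sub_le_of_compatible {j : ℕ} {f a b : ℝ} (ha : a ≤ Real.pi / 2)
    (hb0 : 0 ≤ b)
    (hfa : |Real.sin (j * Real.pi / 2 + a) ^ 2 - f| ≤ tolerance)
    (hfb : |Real.sin (j * Real.pi / 2 + b) ^ 2 - f| ≤ tolerance) : a ≤ b + Real.pi / 30 := by
  by_contra hlt
  push Not at hlt
  have h1 : |Real.sin a ^ 2 - Real.sin b ^ 2| ≤ Real.sin (Real.pi / 30) ^ 2 := by
    rw [← abs_sin_sq_quadrant j]
    have := abs_sub_le (Real.sin (j * Real.pi / 2 + a) ^ 2) f (Real.sin (j * Real.pi / 2 + b) ^ 2)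
    rw [abs_sub_comm f] at this
    unfold tolerance at hfa hfb
    linarith
  have hab : b ≤ a := by linarith [Real.pi_pos]
  have h2 := sin_sq_sub_le hb0 hab ha
  have h3 : Real.sin (Real.pi / 30) < Real.sin (a - b) :=
    Real.sin_lt_sin_of_lt_of_le_pi_div_two (by linarith [Real.pi_pos]) (by linarith) (by linarith)
  have h4 : 0 ≤ Real.sin (Real.pi / 30) :=
    Real.sin_nonneg_of_nonneg_of_le_pi (by positivity) (by linarith [Real.pi_pos])
  have h5 := le_abs_self (Real.sin a ^ 2 - Real.sin b ^ 2)
  nlinarith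

/-- The pair `(q, l)` refines the quadrant `j` for the frequency `f`: all remainders compatible with
the frequency lie in the `l`-th of `q` equal parts of the quadrant. -/
def Refines (j : ℕ) (f : ℝ) (ql : ℕ × ℕ) : Prop :=
  (ql.1 = 3 ∨ ql.1 = 5) ∧ ql.2 < ql.1 ∧ ∀ r : ℝ, 0 ≤ r → r ≤ Real.pi / 2 →
    |Real.sin (j * Real.pi / 2 + r) ^ 2 - f| ≤ tolerance →
      ql.2 * (Real.pi / 2) ≤ ql.1 * r ∧ ql.1 * r ≤ (ql.2 + 1) * (Real.pi / 2)

/-- The compatible remainders have diameter at most `π / 30`. If this set meets both sides of a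
boundary between the three parts of the quadrant, then it lies within one of five parts. -/
theorem exists_refines (j : ℕ) (f : ℝ) : ∃ ql, Refines j f ql := by
  let S : ℝ → Prop := fun r => 0 ≤ r ∧ r ≤ Real.pi / 2 ∧
    |Real.sin (j * Real.pi / 2 + r) ^ 2 - f| ≤ tolerance
  have hS : ∀ {a b}, S a → S b → a ≤ b + Real.pi / 30 := fun ha hb =>
    abs_sub_le_of_compatible ha.2.1 hb.1 ha.2.2 hb.2.2
  have mk : ∀ q l : ℕ, (q = 3 ∨ q = 5) → l < q →
      (∀ r, S r → l * (Real.pi / 2) ≤ q * r ∧ q * r ≤ (l + 1) * (Real.pi / 2)) →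
      ∃ ql, Refines j f ql := fun q l hq hl h =>
    ⟨(q, l), hq, hl, fun r h0 h1 h2 => h r ⟨h0, h1, h2⟩⟩
  have hπ := Real.pi_pos
  by_cases h2 : ∃ r, S r ∧ Real.pi / 6 < r
  swap
  · push Not at h2
    refine mk 3 0 (.inl rfl) (by norm_num) fun r hr => ?_
    have := h2 r hr
    push_cast
    exact ⟨by linarith [hr.1], by linarith⟩
  by_cases h3 : ∃ r, S r ∧ r < Real.pi / 3
  swap
  · push Not at h3
    refine mk 3 2 (.inl rfl) (by norm_num) fun r hr => ?_
    have := h3 r hr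
    push_cast
    exact ⟨by linarith, by linarith [hr.2.1]⟩
  obtain ⟨r2, s2, l2⟩ := h2
  obtain ⟨r3, s3, l3⟩ := h3
  by_cases h1 : ∃ r, S r ∧ r < Real.pi / 6
  · obtain ⟨r1, s1, l1⟩ := h1
    refine mk 5 1 (.inr rfl) (by norm_num) fun r hr => ?_
    have u1 := hS hr s1
    have u2 := hS s2 hr
    push_cast
    exact ⟨by linarith, by linarith⟩
  by_cases h4 : ∃ r, S r ∧ Real.pi / 3 < r
  · obtain ⟨r4, s4, l4⟩ := h4
    refine mk 5 3 (.inr rfl) (by norm_num) fun r hr => ?_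
    have u1 := hS hr s3
    have u2 := hS s4 hr
    push_cast
    exact ⟨by linarith, by linarith⟩
  push Not at h1 h4
  refine mk 3 1 (.inl rfl) (by norm_num) fun r hr => ?_
  have := h1 r hr
  have := h4 r hr
  push_cast
  exact ⟨by linarith, by linarith⟩

/-! ### The size of the batches -/

/-- The constant in the size of the batches. -/
noncomputable def budgetConst : ℝ := 6000 / tolerance

/-- The logarithm of the inverse of the failure probability admitted in a stage. It decreases with
the precision `j` which is already reached, so that the costs of all stages add up to a multiple of
the cost of the last one. -/
noncomputable def logBudget (ε δ : ℝ) (j : ℕ) : ℝ :=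
  Real.log (budgetConst / (δ * ε * max (j : ℝ) 1))

/-- The number of tests in a stage. -/
noncomputable def batchSize (ε δ : ℝ) (j : ℕ) : ℕ := ⌈8 / tolerance ^ 2 * logBudget ε δ j⌉₊

theorem le_budgetConst : 6000 ≤ budgetConst := by
  unfold budgetConst
  rw [le_div_iff₀ tolerance_pos]
  linarith [tolerance_le_one]

section Budget

variable {ε δ : ℝ} {j : ℕ}

theorem three_log_le_logBudget (hε : 0 < ε) (hε1 : ε ≤ 1) (hδ : 0 < δ) (hδ1 : δ < 1)
    (hj : (j : ℝ) < 8 / ε) : 3 * Real.log 9 ≤ logBudget ε δ j := by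
  have h0 : (0 : ℝ) < max (j : ℝ) 1 := lt_max_of_lt_right one_pos
  have h1 : ε * max (j : ℝ) 1 ≤ 8 := by
    rw [lt_div_iff₀ hε] at hj
    rcases max_choice (j : ℝ) 1 with h | h <;> rw [h] <;> linarith
  have h2 : δ * ε * max (j : ℝ) 1 ≤ 8 := by
    rw [mul_assoc]; nlinarith [mul_pos hε h0]
  rw [logBudget, show (3 : ℝ) * Real.log 9 = Real.log (9 ^ 3) by rw [Real.log_pow]; norm_num]
  refine Real.log_le_log (by norm_num) ?_
  rw [le_div_iff₀ (by positivity)]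
  linarith [le_budgetConst]

theorem one_le_log_nine : 1 ≤ Real.log 9 := by
  rw [Real.le_log_iff_exp_le (by norm_num)]
  linarith [Real.exp_one_lt_d9]

theorem batchSize_bounds (h : 3 * Real.log 9 ≤ logBudget ε δ j) :
    2 / tolerance ^ 2 ≤ batchSize ε δ j ∧
      (batchSize ε δ j : ℝ) ≤ 9 / tolerance ^ 2 * logBudget ε δ j := by
  have h9 := one_le_log_nine
  have ht := tolerance_pos
  have ht2 : 1 ≤ 1 / tolerance ^ 2 := by
    rw [one_le_div (by positivity)]
    nlinarith [tolerance_le_one]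
  have hL : 3 ≤ logBudget ε δ j := by linarith
  constructor
  · refine le_trans ?_ (Nat.le_ceil _)
    rw [div_mul_eq_mul_div]
    gcongr
    linarith
  · have h1 := (Nat.ceil_lt_add_one (a := 8 / tolerance ^ 2 * logBudget ε δ j) (by positivity)).le
    have h2 : 1 ≤ 1 / tolerance ^ 2 * logBudget ε δ j := by nlinarith
    unfold batchSize
    calc _ ≤ _ := h1
      _ ≤ 8 / tolerance ^ 2 * logBudget ε δ j + 1 / tolerance ^ 2 * logBudget ε δ j := by linarith
      _ = _ := by ring

/-- The failure probability of a stage, in a form which sums up geometrically over the stages. -/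
theorem stage_failure_le (hε : 0 < ε) (hδ : 0 < δ) (h : 3 * Real.log 9 ≤ logBudget ε δ j) {α : ℝ}
    (hα : j * (Real.pi / 2) ≤ α) :
    batchFail (Real.sin α ^ 2) tolerance (batchSize ε δ j) (batchSize ε δ j) 0 ≤
      δ * (ε * α / 50) := by
  have ht := tolerance_pos
  have hα0 : 0 ≤ α := le_trans (by positivity) hα
  have h0 : (0 : ℝ) < max (j : ℝ) 1 := lt_max_of_lt_right one_pos
  refine (batchFail_le (sq_nonneg _) (Real.sin_sq_le_one _) ht tolerance_le_one
    (batchSize_bounds h).1).trans ?_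
  have h1 : Real.exp (-(batchSize ε δ j * tolerance ^ 2 / 8)) ≤
      δ * ε * max (j : ℝ) 1 * tolerance / 6000 := by
    have h2 : logBudget ε δ j ≤ batchSize ε δ j * tolerance ^ 2 / 8 := by
      have := Nat.le_ceil (8 / tolerance ^ 2 * logBudget ε δ j)
      rw [div_mul_eq_mul_div, div_le_iff₀ (by positivity)] at this
      unfold batchSize
      rw [div_mul_eq_mul_div]
      linarith
    have hK : 0 < budgetConst := by linarith [le_budgetConst]
    calc _ ≤ Real.exp (-logBudget ε δ j) := Real.exp_le_exp.2 (by linarith)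
      _ = _ := by
        rw [Real.exp_neg, logBudget, Real.exp_log (by positivity), budgetConst]
        field_simp
  have h2 : Real.sin α ^ 2 * max (j : ℝ) 1 ≤ α := by
    have hs1 := Real.sin_sq_le_one α
    have hπ := Real.two_le_pi
    rcases max_choice (j : ℝ) 1 with h | h <;> rw [h]
    · have : (j : ℝ) ≤ α := by nlinarith [Nat.cast_nonneg (α := ℝ) j]
      nlinarith [Nat.cast_nonneg (α := ℝ) j]
    · have a1 := Real.sin_le hα0
      have a2 := Real.sin_le_one α
      have a3 := Real.neg_one_le_sin α
      rw [mul_one]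
      rcases le_total 0 (Real.sin α) with a4 | a4
      · nlinarith
      · have a5 : |Real.sin α| ≤ α := by
          have := Real.abs_sin_le_abs (x := α)
          rwa [abs_of_nonneg hα0] at this
        rw [← sq_abs]
        nlinarith [abs_nonneg (Real.sin α), Real.abs_sin_le_one α]
  calc _ ≤ 17 / tolerance * Real.sin α ^ 2 * (δ * ε * max (j : ℝ) 1 * tolerance / 6000) := by
        gcongr
    _ = 17 / 6000 * (δ * ε) * (Real.sin α ^ 2 * max (j : ℝ) 1) := by field_simp
    _ ≤ 17 / 6000 * (δ * ε) * α := by gcongr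
    _ ≤ δ * (ε * α / 50) := by
      have : 0 ≤ δ * ε * α := by positivity
      linarith

theorem logBudget_le_add (hε : 0 < ε) (hδ : 0 < δ) {j' : ℕ} (hj : j' ≤ 5 * j + 4) :
    logBudget ε δ j ≤ logBudget ε δ j' + Real.log 9 := by
  have hK : 0 < budgetConst := by linarith [le_budgetConst]
  have h0 : ∀ i : ℕ, (0 : ℝ) < max (i : ℝ) 1 := fun i => lt_max_of_lt_right one_pos
  have h1 : max (j' : ℝ) 1 ≤ 9 * max (j : ℝ) 1 := by
    have : (j' : ℝ) ≤ 5 * j + 4 := by exact_mod_cast hj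
    have := le_max_left (j : ℝ) 1
    have := le_max_right (j : ℝ) 1
    exact max_le (by linarith) (by linarith)
  have hp := h0 j
  have hp' := h0 j'
  rw [logBudget, logBudget, ← Real.log_mul (by positivity) (by norm_num)]
  refine Real.log_le_log (by positivity) ?_
  rw [div_mul_eq_mul_div, div_le_div_iff₀ (by positivity) (by positivity)]
  have : δ * ε * max (j' : ℝ) 1 ≤ δ * ε * (9 * max (j : ℝ) 1) := by gcongr
  nlinarith

theorem logBudget_le_final (hε : 0 < ε) (hδ : 0 < δ) (hδ1 : δ < 1) (hj : 8 / ε ≤ j) :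
    logBudget ε δ j ≤ (Real.log budgetConst + 1) * max 1 (Real.logb 2 δ⁻¹) := by
  have hK := le_budgetConst
  have h0 : (0 : ℝ) < max (j : ℝ) 1 := lt_max_of_lt_right one_pos
  have h1 : 1 ≤ ε * max (j : ℝ) 1 := by
    rw [div_le_iff₀ hε] at hj
    nlinarith [le_max_left (j : ℝ) 1]
  have h2 : logBudget ε δ j ≤ Real.log (budgetConst * δ⁻¹) := by
    refine Real.log_le_log (div_pos (by linarith) (by positivity)) ?_
    rw [div_eq_mul_inv, mul_assoc δ, mul_inv]
    have : (ε * max (j : ℝ) 1)⁻¹ ≤ 1 := inv_le_one_of_one_le₀ h1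
    have h3 : 0 ≤ δ⁻¹ := by positivity
    nlinarith [mul_le_mul_of_nonneg_left this h3]
  rw [Real.log_mul (by linarith) (by positivity)] at h2
  have h3 : Real.log δ⁻¹ ≤ Real.logb 2 δ⁻¹ := by
    have h4 : 0 ≤ Real.log δ⁻¹ := Real.log_nonneg ((one_le_inv₀ hδ).2 hδ1.le)
    rw [Real.logb, le_div_iff₀ (Real.log_pos one_lt_two)]
    nlinarith [Real.log_two_lt_d9]
  have h5 : 0 ≤ Real.log budgetConst := Real.log_nonneg (by linarith)
  have h6 := le_max_left 1 (Real.logb 2 δ⁻¹)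
  have h7 := le_max_right 1 (Real.logb 2 δ⁻¹)
  nlinarith

end Budget

/-! ### The estimation algorithm -/

/-- The classical data of the search for the angle `θ`: it is known that
`j π / 2 ≤ M θ ≤ (j + 1) π / 2`, and in the present batch, `seen` tests have been performed for the
multiple `M`, with `ones` successes. -/
structure SearchState where
  M : ℕ
  j : ℕ
  ones : ℕ
  seen : ℕ

namespace SearchState

/-- At the beginning, `θ` is only known to lie in the first quadrant. -/
def init : SearchState := ⟨1, 0, 0, 0⟩

/-- The state after a further test. -/
noncomputable def update (ε δ : ℝ) (σ : SearchState) (b : Bool) : SearchState :=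
  let ones' := σ.ones + b.toNat
  if σ.seen + 1 < batchSize ε δ σ.j then ⟨σ.M, σ.j, ones', σ.seen + 1⟩
  else
    let ql := (exists_refines σ.j ((ones' : ℝ) / batchSize ε δ σ.j)).choose
    ⟨ql.1 * σ.M, ql.1 * σ.j + ql.2, 0, 0⟩

/-- The lower bound for the angle. -/
noncomputable def lower (σ : SearchState) : ℝ := σ.j * (Real.pi / 2) / σ.M

/-- The upper bound for the angle. -/
noncomputable def upper (σ : SearchState) : ℝ :=
  min ((σ.j + 1) * (Real.pi / 2) / σ.M) (Real.pi / 2)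

/-- The number of amplification steps in the result: the angle `(2 k + 1) θ` stays below `π / 2`. -/
noncomputable def steps (σ : SearchState) : ℕ := ⌊(Real.pi / 2 / σ.upper - 1) / 2⌋₊

/-- The estimate, from above, of the factor `sin θ / sin ((2 k + 1) θ)`. -/
noncomputable def factor (σ : SearchState) : ℝ :=
  Real.sin σ.upper / Real.sin ((2 * σ.steps + 1) * σ.lower)

/-- `σ` localizes the angle `θ` in a quadrant of `M θ`. -/
structure Localizes (σ : SearchState) (θ : ℝ) : Prop where
  odd : Odd σ.M
  le : σ.j * (Real.pi / 2) ≤ σ.M * θ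
  ge : σ.M * θ ≤ (σ.j + 1) * (Real.pi / 2)

/-- A refinement by a sufficiently precise frequency localizes the angle better. -/
theorem Localizes.refine {M j ones seen : ℕ} {θ f : ℝ} (h : Localizes ⟨M, j, ones, seen⟩ θ)
    {ql : ℕ × ℕ} (hr : Refines j f ql) (hf : |f - Real.sin (M * θ) ^ 2| ≤ tolerance) :
    Localizes ⟨ql.1 * M, ql.1 * j + ql.2, 0, 0⟩ θ := by
  obtain ⟨hq, hl, hr⟩ := hr
  obtain ⟨ho, h1, h2⟩ := h
  simp only at ho h1 h2
  have h3 := hr (M * θ - j * (Real.pi / 2)) (by linarith) (by linarith) (by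
    rw [abs_sub_comm, show j * Real.pi / 2 + (M * θ - j * (Real.pi / 2)) = M * θ by ring]
    exact hf)
  refine ⟨?_, ?_, ?_⟩
  · refine Odd.mul ?_ ho
    rcases hq with hq | hq <;> rw [hq] <;> decide
  · push_cast; linarith [h3.1]
  · push_cast; linarith [h3.2]

section Output

variable {σ : SearchState} {θ ε : ℝ}

/-- A relative error of the angle leads to a relative error of the sine of at most twice the
size. -/
theorem sin_le_of_sub_le {x y : ℝ} (hx : 0 ≤ x) (hxy : x ≤ y) (hy : y ≤ Real.pi / 2)
    (hε : 0 < ε) (hd : y - x ≤ ε / 8 * x) : Real.sin y ≤ (1 + ε / 4) * Real.sin x := by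
  have hπ := Real.pi_pos
  have k1 := Real.mul_le_sin hx (by linarith)
  have k2 : Real.sin y - Real.sin x ≤ y - x := by
    have := Real.abs_sin_sub_sin_le y x
    rw [abs_of_nonneg (sub_nonneg.2 hxy)] at this
    exact (le_abs_self _).trans this
  have k3 : x ≤ 2 * Real.sin x := by
    have k4 : x ≤ Real.pi / 2 * Real.sin x := by
      rw [div_mul_eq_mul_div, le_div_iff₀ two_pos]
      rw [div_mul_eq_mul_div, div_le_iff₀ hπ] at k1
      linarith
    have k5 := Real.sin_nonneg_of_nonneg_of_le_pi hx (by linarith)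
    nlinarith [Real.pi_le_four]
  have := mul_le_mul_of_nonneg_left k3 (by positivity : 0 ≤ ε / 8)
  linarith

/-- The properties of the final estimate: amplification by `2 k + 1` leads to a constant amplitude,
and the factor is precise up to the relative error `ε`, from above. -/
theorem Localizes.output (h : σ.Localizes θ) (hθ : 0 < θ) (hθ' : θ ≤ Real.pi / 2) (hε : 0 < ε)
    (hε1 : ε ≤ 1) (hj : 8 / ε ≤ σ.j) :
    (2 * σ.steps + 1) * θ ≤ Real.pi / 2 ∧ 1 / 4 ≤ Real.sin ((2 * σ.steps + 1) * θ) ∧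
      Real.sin θ ≤ σ.factor ∧ Real.sin θ ≤ σ.factor * Real.sin ((2 * σ.steps + 1) * θ) ∧
      σ.factor * Real.sin ((2 * σ.steps + 1) * θ) ≤ (1 + ε) * Real.sin θ := by
  have hπ := Real.pi_pos
  obtain ⟨ho, h1, h2⟩ := h
  have hM : (0 : ℝ) < σ.M := by exact_mod_cast ho.pos
  have hj8 : 8 ≤ ε * σ.j := by rwa [div_le_iff₀ hε, mul_comm] at hj
  have hj' : (8 : ℝ) ≤ σ.j := by nlinarith [Nat.cast_nonneg (α := ℝ) σ.j]
  set a := σ.lower with ha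
  set b := σ.upper with hb
  have ha0 : 0 < a := by rw [ha, lower]; positivity
  have haθ : a ≤ θ := by rw [ha, lower, div_le_iff₀ hM]; linarith
  have hθb : θ ≤ b := by
    rw [hb, upper]
    exact le_min (by rw [le_div_iff₀ hM]; linarith) hθ'
  have hb2 : b ≤ Real.pi / 2 := min_le_right _ _
  have hb0 : 0 < b := hθ.trans_le hθb
  have hba : b - a ≤ a / σ.j := by
    have : b ≤ (σ.j + 1) * (Real.pi / 2) / σ.M := min_le_left _ _
    have e : (σ.j + 1) * (Real.pi / 2) / σ.M = a + a / σ.j := by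
      rw [ha, lower]; field_simp
    linarith
  -- the number of amplification steps
  set m : ℝ := 2 * σ.steps + 1 with hm
  have hm1 : 1 ≤ m := by rw [hm]; linarith [Nat.cast_nonneg (α := ℝ) σ.steps]
  have hq1 : 1 ≤ Real.pi / 2 / b := by rwa [one_le_div hb0]
  have hmb : m * b ≤ Real.pi / 2 := by
    have h3 : (σ.steps : ℝ) ≤ (Real.pi / 2 / b - 1) / 2 := Nat.floor_le (by linarith)
    have h4 : m ≤ Real.pi / 2 / b := by rw [hm]; linarith
    rwa [le_div_iff₀ hb0] at h4
  have hmb' : Real.pi / 6 ≤ m * b := by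
    have h3 : (Real.pi / 2 / b - 1) / 2 < σ.steps + 1 := Nat.lt_floor_add_one _
    have h4 : Real.pi / 2 / b ≤ 3 * m := by rw [hm] at hm1 ⊢; linarith
    rw [div_le_iff₀ hb0] at h4
    linarith
  have hm0 : 0 ≤ m := by linarith
  have hma : m * a ≤ m * θ := mul_le_mul_of_nonneg_left haθ hm0
  have hmθ : m * θ ≤ m * b := mul_le_mul_of_nonneg_left hθb hm0
  have hma0 : 0 < m * a := by positivity
  have sa : 0 < Real.sin (m * a) := Real.sin_pos_of_pos_of_lt_pi hma0 (by linarith)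
  have sθ : 0 < Real.sin θ := Real.sin_pos_of_pos_of_lt_pi hθ (by linarith)
  have smono : Real.sin (m * a) ≤ Real.sin (m * θ) :=
    Real.sin_le_sin_of_le_of_le_pi_div_two (by linarith) (by linarith) hma
  have hba8 : b ≤ a * (1 + 1 / σ.j) := by
    have : a * (1 + 1 / σ.j) = a + a / σ.j := by ring
    linarith
  have hinv : 1 / (σ.j : ℝ) ≤ ε / 8 := by
    rw [div_le_div_iff₀ (by linarith) (by norm_num)]; linarith
  have haj : a / σ.j ≤ a * (ε / 8) := by
    rw [div_eq_mul_one_div]; exact mul_le_mul_of_nonneg_left hinv ha0.le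
  have hbθ : b - θ ≤ ε / 8 * θ := by
    have h5 := mul_le_mul_of_nonneg_left haθ (by positivity : 0 ≤ ε / 8)
    linarith
  have hθa : m * θ - m * a ≤ ε / 8 * (m * a) := by
    have h5 : θ - a ≤ ε / 8 * a := by linarith
    have := mul_le_mul_of_nonneg_left h5 hm0
    linarith
  have s1 : Real.sin b ≤ (1 + ε / 4) * Real.sin θ := sin_le_of_sub_le hθ.le hθb hb2 hε hbθ
  have s2 : Real.sin (m * θ) ≤ (1 + ε / 4) * Real.sin (m * a) :=
    sin_le_of_sub_le hma0.le hma (by linarith) hε hθa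
  have k1 : Real.sin θ ≤ Real.sin b :=
    Real.sin_le_sin_of_le_of_le_pi_div_two (by linarith) hb2 hθb
  refine ⟨by linarith, ?_, ?_, ?_, ?_⟩
  · have k1 := Real.mul_le_sin (hma0.le.trans hma) (by linarith : m * θ ≤ Real.pi / 2)
    have k2 : Real.pi / 8 ≤ m * θ := by
      have : b ≤ 9 / 8 * θ := by
        have := mul_le_mul_of_nonneg_right hε1 hθ.le
        linarith
      have := mul_le_mul_of_nonneg_left this hm0
      linarith
    have k3 : 2 / Real.pi * (Real.pi / 8) ≤ 2 / Real.pi * (m * θ) :=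
      mul_le_mul_of_nonneg_left k2 (by positivity)
    have k4 : 2 / Real.pi * (Real.pi / 8) = 1 / 4 := by field_simp; norm_num
    linarith
  · rw [factor, le_div_iff₀ sa]
    exact (mul_le_of_le_one_right sθ.le (Real.sin_le_one _)).trans k1
  · rw [factor, div_mul_eq_mul_div, le_div_iff₀ sa]
    exact mul_le_mul k1 smono sa.le (sθ.le.trans k1)
  · rw [factor, div_mul_eq_mul_div, div_le_iff₀ sa]
    have k0 : 0 ≤ Real.sin (m * θ) := sa.le.trans smono
    calc Real.sin b * Real.sin (m * θ)
        ≤ ((1 + ε / 4) * Real.sin θ) * ((1 + ε / 4) * Real.sin (m * a)) :=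
          mul_le_mul s1 s2 k0 (by positivity)
      _ = (1 + ε / 4) ^ 2 * (Real.sin θ * Real.sin (m * a)) := by ring
      _ ≤ (1 + ε) * (Real.sin θ * Real.sin (m * a)) :=
          mul_le_mul_of_nonneg_right (by nlinarith) (by positivity)
      _ = (1 + ε) * Real.sin θ * Real.sin (m * a) := by ring

end Output

end SearchState

/-! ### Analysis of the algorithm -/

/-- The state of the search after given measurement outcomes. -/
noncomputable def searchState (ε δ : ℝ) (m : ℕ) (h : History) : SearchState :=
  h.foldl (fun σ z => σ.update ε δ (targetBit m z)) SearchState.init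

theorem searchState_append (ε δ : ℝ) (m : ℕ) (h : History) (z : Σ n : ℕ, Qubits n) :
    searchState ε δ m (h ++ [z]) = (searchState ε δ m h).update ε δ (targetBit m z) := by
  simp [searchState]

open Classical in
/-- The algorithm: it localizes the angle `θ` by tests of `sin² (M θ)` for growing odd `M`, until
it is known with a sufficient relative precision, and returns an amplification circuit. -/
noncomputable def searchAlgorithm {𝒢 : GateSet} (IX IH : Implementation 𝒢 1) :
    EncodingAlgorithm 𝒢 := fun ε δ _ s γ h =>
  if 8 / ε ≤ (searchState ε δ s.m h).j then
    .halt (workspace IX IH s + 1) (amplifyCircuit IX IH s (searchState ε δ s.m h).steps)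
      (γ * (searchState ε δ s.m h).factor)
  else .run (totalWires IX IH s) (testCircuit IX IH s ((searchState ε δ s.m h).M / 2))

/-- The constant of the cost of the search. -/
noncomputable def costConst : ℝ := 9 / tolerance ^ 2

theorem costConst_pos : 0 < costConst := by
  have := tolerance_pos
  unfold costConst
  positivity

/-- The state of the search at the beginning of a stage, if no stage has failed so far: the angle
`θ` is localized, and the number `t` of executed gates is bounded in terms of the present multiple
`M`; here `G` bounds the number of gates for one amplification step. -/
structure StageInvariant (ε δ θ G : ℝ) (M j t : ℕ) : Prop where
  localizes : SearchState.Localizes ⟨M, j, 0, 0⟩ θ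
  bounded : ε * (M * θ) ≤ 100
  cost : (t : ℝ) ≤ costConst * (M * G) * logBudget ε δ j

/-- A stage with a sufficiently precise frequency leads to the next stage. -/
theorem StageInvariant.next {ε δ θ G : ℝ} {M j t t' : ℕ} (hI : StageInvariant ε δ θ G M j t)
    (hε : 0 < ε) (hε1 : ε ≤ 1) (hδ : 0 < δ) (hδ1 : δ < 1) (hG : 0 ≤ G)
    (hj : (j : ℝ) < 8 / ε)
    (ht' : (t' : ℝ) ≤ costConst * (M * G) * logBudget ε δ j + batchSize ε δ j * (M * G))
    {f : ℝ} (hf : |f - Real.sin (M * θ) ^ 2| ≤ tolerance) {ql : ℕ × ℕ} (hr : Refines j f ql) :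
    3 * M ≤ ql.1 * M ∧ StageInvariant ε δ θ G (ql.1 * M) (ql.1 * j + ql.2) t' := by
  have hq3 : 3 ≤ ql.1 := by rcases hr.1 with h | h <;> omega
  have hq5 : ql.1 ≤ 5 := by rcases hr.1 with h | h <;> omega
  have hMM : 3 * M ≤ ql.1 * M := Nat.mul_le_mul_right _ hq3
  have hj' : ql.1 * j + ql.2 ≤ 5 * j + 4 := by
    have := hr.2.1
    have := Nat.mul_le_mul_right j hq5
    omega
  have hloc := hI.localizes.refine hr hf
  have hL := three_log_le_logBudget hε hε1 hδ hδ1 hj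
  have hL' := logBudget_le_add (δ := δ) hε hδ hj'
  have h9 := one_le_log_nine
  refine ⟨hMM, hloc, ?_, ?_⟩
  · have h1 := hI.localizes.ge
    have h2 : ε * j ≤ 8 := by rw [lt_div_iff₀ hε] at hj; linarith
    have h3 : ((ql.1 * M : ℕ) : ℝ) * θ ≤ 5 * (((j : ℝ) + 1) * (Real.pi / 2)) := by
      push_cast
      rw [mul_assoc]
      have hM0 : 0 ≤ (M : ℝ) * θ := le_trans (by positivity) hI.localizes.le
      have : (ql.1 : ℝ) ≤ 5 := by exact_mod_cast hq5
      exact (mul_le_mul_of_nonneg_right this hM0).trans (by linarith [h1])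
    calc _ ≤ ε * (5 * (((j : ℝ) + 1) * (Real.pi / 2))) := mul_le_mul_of_nonneg_left h3 hε.le
      _ = 5 * ((ε * j + ε) * (Real.pi / 2)) := by ring
      _ ≤ 5 * ((8 + 1) * (4 / 2)) := by gcongr; exact Real.pi_le_four
      _ ≤ 100 := by norm_num
  · have hb := (batchSize_bounds hL).2
    have hMG : 0 ≤ M * G := by positivity
    have hB := costConst_pos
    have h1 : (3 : ℝ) * (M * G) ≤ (ql.1 * M : ℕ) * G := by
      have : (3 : ℝ) * M ≤ (ql.1 * M : ℕ) := by exact_mod_cast hMM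
      nlinarith
    have h2 := mul_le_mul_of_nonneg_right hb hMG
    rw [← costConst] at h2
    have h3 : 0 ≤ logBudget ε δ (ql.1 * j + ql.2) := by linarith
    calc (t' : ℝ) ≤ costConst * (M * G) * (2 * logBudget ε δ j) := by linarith
      _ ≤ costConst * (M * G) * (3 * logBudget ε δ (ql.1 * j + ql.2)) := by
        exact mul_le_mul_of_nonneg_left (by linarith) (by positivity)
      _ = costConst * (3 * (M * G)) * logBudget ε δ (ql.1 * j + ql.2) := by ring
      _ ≤ _ := by gcongr

namespace BlockEncoding

variable {𝒢 : GateSet} {N : ℕ} (E : BlockEncoding 𝒢 1 N) {IX IH : Implementation 𝒢 1}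

/-- The success probability within a stage, if the next stages succeed with the probability given
by `hnext`. -/
theorem one_le_success_batch (hX : IX.Implements pauliX) (hH : IH.Implements hadamard)
    (hE : E.P₁ = Matrix.of fun _ b => if b = (fun _ => false) then 1 else 0)
    {θ : ℝ} (hθ : Real.sin θ = E.efficiency) {ε δ : ℝ} (R : Set (Result 𝒢 E.signature))
    {M j : ℕ} (hM : Odd M) (hj : (j : ℝ) < 8 / ε) {T Φ : ℝ} (hΦ : 0 ≤ Φ)
    (hnext : ∀ (h : History) (t : ℕ) (f : ℝ) (ql : ℕ × ℕ), Refines j f ql →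
      |f - Real.sin (M * θ) ^ 2| ≤ tolerance →
      searchState ε δ E.m h = ⟨ql.1 * M, ql.1 * j + ql.2, 0, 0⟩ →
      (t : ℝ) ≤ T + batchSize ε δ j * (M * (stepCost IX IH * E.gateCount)) →
      1 ≤ (searchAlgorithm IX IH ε δ N E.signature E.γ).success E.subroutines R (.running h t) +
        ENNReal.ofReal Φ)
    (r : ℕ) : ∀ (h : History) (t c seen : ℕ), seen + r + 1 = batchSize ε δ j →
      searchState ε δ E.m h = ⟨M, j, c, seen⟩ →
      (t : ℝ) ≤ T + seen * (M * (stepCost IX IH * E.gateCount)) →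
      1 ≤ (searchAlgorithm IX IH ε δ N E.signature E.γ).success E.subroutines R (.running h t) +
        ENNReal.ofReal (batchFail (Real.sin (M * θ) ^ 2) tolerance (batchSize ε δ j) (r + 1) c +
          Φ) := by
  set A := searchAlgorithm IX IH ε δ N E.signature E.γ with hA
  set p := Real.sin (M * θ) ^ 2 with hp
  set n := batchSize ε δ j with hn
  have hp0 : 0 ≤ p := sq_nonneg _
  have hp1 : p ≤ 1 := Real.sin_sq_le_one _
  set c₀ := (testCircuit IX IH E.signature (M / 2)).expand E.subroutines with hc₀
  have hMM : 2 * (M / 2) + 1 = M := Nat.two_mul_div_two_add_one_of_odd hM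
  have hlen : (c₀.length : ℝ) ≤ M * (stepCost IX IH * E.gateCount) := by
    have := E.length_testCircuit_le IX IH hE (M / 2)
    rw [hMM] at this
    exact_mod_cast this
  have hmeas : ∑ y, (if targetBit E.m ⟨_, y⟩ then c₀.measure y else 0) = ENNReal.ofReal p := by
    rw [hc₀, E.measure_testCircuit hX hH hE hθ, hp]
    have : (2 * ((M / 2 : ℕ) : ℝ) + 1) = M := by exact_mod_cast hMM
    rw [this]
  have step : ∀ (r : ℕ) (h : History) (t c seen : ℕ),
      searchState ε δ E.m h = ⟨M, j, c, seen⟩ →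
      (∀ y, 1 ≤ A.success E.subroutines R (.running (h ++ [⟨_, y⟩]) (t + c₀.length)) +
        ENNReal.ofReal (batchFail p tolerance n r (c + (targetBit E.m
          ⟨totalWires IX IH E.signature, y⟩).toNat) + Φ)) →
      1 ≤ A.success E.subroutines R (.running h t) +
        ENNReal.ofReal (batchFail p tolerance n (r + 1) c + Φ) := by
    intro r h t c seen hst hy
    have hrun : A h = .run _ (testCircuit IX IH E.signature (M / 2)) := by
      have e : searchState ε δ E.signature.m h = ⟨M, j, c, seen⟩ := hst
      simp only [hA, searchAlgorithm, e, if_neg (not_le.2 hj)]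
    have := Procedure.one_le_success_add A E.subroutines R hrun
      (fun y => targetBit E.m ⟨_, y⟩) hp0 hp1 hmeas
      (φ := fun b => batchFail p tolerance n r (c + b.toNat) + Φ)
      (fun b => add_nonneg (batchFail_nonneg hp0 hp1 _ _ _) hΦ) hy
    refine this.trans_eq ?_
    congr 2
    simp only [batchFail, Bool.toNat_true, Bool.toNat_false, add_zero]
    ring
  induction r with
  | zero =>
    intro h t c seen hseen hst ht
    refine step 0 h t c seen hst fun y => ?_
    set c' := c + (targetBit E.m ⟨totalWires IX IH E.signature, y⟩).toNat with hc'
    by_cases hf : |(c' : ℝ) / n - p| ≤ tolerance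
    · have h0 : batchFail p tolerance n 0 c' = 0 := by simp only [batchFail, if_pos hf]
      rw [h0, zero_add]
      refine hnext _ _ ((c' : ℝ) / n) _
        (exists_refines j ((c' : ℝ) / n)).choose_spec hf ?_ ?_
      · rw [searchState_append, hst, SearchState.update]
        simp only
        rw [if_neg (by omega)]
      · have e : ((seen : ℝ) + 1) = n := by exact_mod_cast (by omega : seen + 1 = n)
        rw [← e]
        push_cast
        linarith
    · have h0 : batchFail p tolerance n 0 c' = 1 := by simp only [batchFail, if_neg hf]
      rw [h0]
      refine le_add_of_nonneg_of_le zero_le ?_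
      rw [← ENNReal.ofReal_one]
      exact ENNReal.ofReal_le_ofReal (by linarith)
  | succ r ih =>
    intro h t c seen hseen hst ht
    refine step (r + 1) h t c seen hst fun y => ?_
    refine ih _ _ _ (seen + 1) (by omega) ?_ ?_
    · rw [searchState_append, hst, SearchState.update]
      simp only
      rw [if_pos (by omega)]
    · push_cast
      linarith

/-- The potential argument: from the beginning of a stage with the multiple `M` of the angle, the
algorithm fails with probability at most `δ (1 - ε M θ / 100)`, since each stage uses up a part of
the failure probability proportional to `M`, and `M` grows geometrically. -/
theorem one_le_success_stage (hX : IX.Implements pauliX) (hH : IH.Implements hadamard)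
    (hE : E.P₁ = Matrix.of fun _ b => if b = (fun _ => false) then 1 else 0)
    {θ : ℝ} (hθ : Real.sin θ = E.efficiency) (hθ0 : 0 < θ) {ε δ : ℝ} (hε : 0 < ε) (hε1 : ε ≤ 1)
    (hδ : 0 < δ) (hδ1 : δ < 1) (R : Set (Result 𝒢 E.signature))
    (hR : ∀ (M j t : ℕ), 8 / ε ≤ j →
      StageInvariant ε δ θ (stepCost IX IH * E.gateCount) M j t →
      (⟨t, workspace IX IH E.signature + 1, amplifyCircuit IX IH E.signature
        (SearchState.mk M j 0 0).steps, E.γ * (SearchState.mk M j 0 0).factor⟩ :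
        Result 𝒢 E.signature) ∈ R)
    (D : ℕ) : ∀ (h : History) (t M j : ℕ), ⌊100 / (ε * θ)⌋₊ + 1 - M ≤ D →
      searchState ε δ E.m h = ⟨M, j, 0, 0⟩ →
      StageInvariant ε δ θ (stepCost IX IH * E.gateCount) M j t →
      1 ≤ (searchAlgorithm IX IH ε δ N E.signature E.γ).success E.subroutines R (.running h t) +
        ENNReal.ofReal (δ * (1 - ε * (M * θ) / 100)) := by
  have hMD : ∀ {M j t : ℕ}, StageInvariant ε δ θ (stepCost IX IH * E.gateCount) M j t →
      M < ⌊100 / (ε * θ)⌋₊ + 1 := fun {M j t} hI => by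
    have := hI.bounded
    refine Nat.lt_add_one_iff.2 (Nat.le_floor ?_)
    rw [le_div_iff₀ (by positivity)]
    linarith
  induction D with
  | zero => intro h t M j hD _ hI; have := hMD hI; omega
  | succ D ih =>
    intro h t M j hD hst hI
    have e : searchState ε δ E.signature.m h = ⟨M, j, 0, 0⟩ := hst
    by_cases hj : 8 / ε ≤ j
    · have hhalt : searchAlgorithm IX IH ε δ N E.signature E.γ h = .halt _ (amplifyCircuit IX IH
          E.signature (SearchState.mk M j 0 0).steps) (E.γ * (SearchState.mk M j 0 0).factor) := by
        simp only [searchAlgorithm, e, if_pos hj]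
      rw [Procedure.success_halt _ _ R hhalt (hR M j t hj hI)]
      exact le_self_add
    · rw [not_le] at hj
      have hL := three_log_le_logBudget hε hε1 hδ hδ1 hj
      have hn := (batchSize_bounds hL).1
      have hn1 : 0 < batchSize ε δ j := by
        have : (0 : ℝ) < batchSize ε δ j := lt_of_lt_of_le (by have := tolerance_pos; positivity) hn
        exact_mod_cast this
      obtain ⟨r, hr⟩ := Nat.exists_eq_add_of_lt hn1
      have hM0 : 0 ≤ (M : ℝ) * θ := by positivity
      have hG : (0 : ℝ) ≤ stepCost IX IH * E.gateCount := by positivity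
      -- after this stage, the multiple is at least `3 M`, still with a nonnegative potential
      have hMθ : ε * (M * θ) ≤ 18 := by
        have h1 := hI.localizes.ge
        have h2 : ε * j ≤ 8 := by rw [lt_div_iff₀ hε] at hj; linarith
        calc ε * (M * θ) ≤ ε * (((j : ℝ) + 1) * (Real.pi / 2)) :=
              mul_le_mul_of_nonneg_left h1 hε.le
          _ = (ε * j + ε) * (Real.pi / 2) := by ring
          _ ≤ (8 + 1) * (4 / 2) := by gcongr; exact Real.pi_le_four
          _ = 18 := by norm_num
      have hΦ : 0 ≤ δ * (1 - ε * (3 * (M * θ)) / 100) := mul_nonneg hδ.le (by linarith)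
      have hbatch := E.one_le_success_batch hX hH hE hθ R (M := M) (j := j) (ε := ε) (δ := δ)
        hI.localizes.odd hj (T := costConst * (M * (stepCost IX IH * E.gateCount)) *
          logBudget ε δ j) hΦ ?_ r h t 0 0 (by omega) hst (by simpa using hI.cost)
      · refine hbatch.trans (add_le_add_right (ENNReal.ofReal_le_ofReal ?_) _)
        have hfail := stage_failure_le hε hδ hL hI.localizes.le
        have er : r + 1 = batchSize ε δ j := by omega
        rw [er]
        simp only at hfail
        calc _ ≤ δ * (ε * (M * θ) / 50) + δ * (1 - ε * (3 * (M * θ)) / 100) := by gcongr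
          _ = _ := by ring
      · intro h' t' f ql hql hf hst' ht'
        obtain ⟨hMM, hI'⟩ := hI.next hε hε1 hδ hδ1 hG hj ht' hf hql
        refine (ih h' t' _ _ ?_ hst' hI').trans (add_le_add_right (ENNReal.ofReal_le_ofReal ?_) _)
        · have := hI.localizes.odd.pos
          simp only at this
          omega
        · have h3 : (3 : ℝ) * M ≤ (ql.1 * M : ℕ) := by exact_mod_cast hMM
          have h4 : 3 * (M * θ) ≤ (ql.1 * M : ℕ) * θ := by
            have := mul_le_mul_of_nonneg_right h3 hθ0.le
            linarith
          gcongr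

theorem gateCount_replace_le (V : QUnitary E.m) (I : Implementation 𝒢 E.m) (hI : I.Implements V)
    (γ' : ℝ) : (E.replace V I hI γ').gateCount ≤ I.gateCount + E.gateCount := by
  change I.gateCount + E.impl₁.gateCount + E.impl₂.gateCount ≤
    I.gateCount + (E.implU.gateCount + E.impl₁.gateCount + E.impl₂.gateCount)
  omega

theorem efficiency_replace_amplify
    (hE : E.P₁ = Matrix.of fun _ b => if b = (fun _ => false) then 1 else 0)
    {θ : ℝ} (hθ : Real.sin θ = E.efficiency) (k : ℕ) (I : Implementation 𝒢 E.m)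
    (hI : I.Implements (E.amplify k)) (γ' : ℝ) :
    (E.replace (E.amplify k) I hI γ').efficiency = |Real.sin ((2 * k + 1) * θ)| := by
  obtain ⟨a, ha, hblock⟩ := amplify_block hE hθ k
  have h : (E.replace (E.amplify k) I hI γ').efficiency =
      ‖E.P₂ * (E.amplify k : Matrix (Qubits E.m) (Qubits E.m) ℂ) * E.P₁ᴴ‖ := rfl
  rw [h, hblock, norm_smul, Complex.norm_real, Real.norm_eq_abs, ← ha, abs_mul, hθ,
    abs_of_nonneg (show 0 ≤ E.efficiency from norm_nonneg _), mul_comm]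
  rfl

theorem norm_encoded {x : Fin N → ℂ} (hEx : E.EncodesVector x 0) :
    ‖Matrix.replicateCol (Fin 1) x‖ = E.γ * E.efficiency ∧
      (E.γ : ℂ) • E.block = Matrix.replicateCol (Fin 1) x := by
  obtain ⟨-, hγ, hex⟩ := hEx
  have hx : (E.γ : ℂ) • E.block = Matrix.replicateCol (Fin 1) x := by
    rw [zero_mul] at hex
    exact sub_eq_zero.1 (norm_le_zero_iff.1 hex)
  refine ⟨?_, hx⟩
  rw [← hx, norm_smul, Complex.norm_of_nonneg ((norm_nonneg _).trans hγ)]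
  rfl

/-- If `φ` approximates `sin θ / sin ((2 k + 1) θ)` from above, then the amplified unitary with the
normalization `γ φ` encodes the same vector as before. -/
theorem EncodesVector.replace_amplify {x : Fin N → ℂ} (hEx : E.EncodesVector x 0)
    (hη : 0 < E.efficiency) {θ ε φ : ℝ} (hθ : Real.sin θ = E.efficiency) (k : ℕ)
    (I : Implementation 𝒢 E.m) (hI : I.Implements (E.amplify k)) (h1 : Real.sin θ ≤ φ)
    (h2 : Real.sin θ ≤ φ * Real.sin ((2 * k + 1) * θ))
    (h3 : φ * Real.sin ((2 * k + 1) * θ) ≤ (1 + ε) * Real.sin θ) :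
    (E.replace (E.amplify k) I hI (E.γ * φ)).EncodesVector x ε := by
  obtain ⟨hxn, hx⟩ := E.norm_encoded hEx
  obtain ⟨hE, hγ, -⟩ := hEx
  have hγ0 : 0 ≤ E.γ := (norm_nonneg _).trans hγ
  obtain ⟨a, ha, hblock⟩ := amplify_block hE hθ k
  have hb : (E.replace (E.amplify k) I hI (E.γ * φ)).block = (a : ℂ) • E.block := hblock
  have hg : (E.replace (E.amplify k) I hI (E.γ * φ)).γ = E.γ * φ := rfl
  refine ⟨hE, ?_, ?_⟩
  · rw [hxn, hg, ← hθ]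
    exact mul_le_mul_of_nonneg_left h1 hγ0
  · have e : ((E.γ * φ : ℝ) : ℂ) * a - E.γ = ((E.γ * (φ * a - 1) : ℝ) : ℂ) := by
      push_cast; ring
    rw [hb, hg, hxn, ← hx, smul_smul, ← sub_smul, norm_smul, e, Complex.norm_real,
      Real.norm_eq_abs, abs_mul, abs_of_nonneg hγ0]
    change E.γ * |φ * a - 1| * E.efficiency ≤ _
    rw [← ha, hθ] at h2 h3
    have h4 : φ * a ≤ 1 + ε := le_of_mul_le_mul_right (by linarith) hη
    have h5 : 1 ≤ φ * a := le_of_mul_le_mul_right (by linarith) hη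
    rw [abs_of_nonneg (by linarith)]
    have : E.γ * (φ * a - 1) * E.efficiency ≤ E.γ * ε * E.efficiency := by gcongr; linarith
    linarith

end BlockEncoding

theorem theorem2p5 :
    ∃ Cie : ℝ, 1 / 4 ≤ Cie ∧
      ∀ 𝒢 : GateSet, 𝒢.IsUniversal →
        ∃ (C : ℝ) (A : EncodingAlgorithm 𝒢),
          ∀ (ε δ : ℝ), 0 < ε → ε ≤ 1 → 0 < δ → δ < 1 →
            ∀ (N : ℕ) (x : Fin N → ℂ) (E : BlockEncoding 𝒢 1 N),
              E.EncodesVector x 0 → 0 < E.efficiency →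
                ENNReal.ofReal (1 - δ) ≤
                  (A ε δ N E.signature E.γ).prob E.subroutines
                    {r | ∃ (V : QUnitary E.m) (hV : (E.outputImpl r).Implements V),
                      (E.replace V (E.outputImpl r) hV r.γ).EncodesVector x ε ∧
                      Cie ≤ (E.replace V (E.outputImpl r) hV r.γ).efficiency ∧
                      (r.executed : ℝ) ≤
                        C * (ε⁻¹ * E.efficiency⁻¹ * max 1 (Real.logb 2 δ⁻¹) * E.gateCount) ∧
                      ((E.replace V (E.outputImpl r) hV r.γ).gateCount : ℝ) ≤
                        C * (E.efficiency⁻¹ * E.gateCount)} := by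
  refine ⟨1 / 4, le_rfl, fun 𝒢 h𝒢 => ?_⟩
  obtain ⟨⟨IX, hX⟩, ⟨IH, hH⟩, -⟩ := h𝒢
  set C₁ : ℝ := costConst * 100 * (Real.log budgetConst + 1) * stepCost IX IH with hC₁
  set C₂ : ℝ := 2 * stepCost IX IH + 1 with hC₂
  have hlogK : 0 ≤ Real.log budgetConst := Real.log_nonneg (by linarith [le_budgetConst])
  have hB := costConst_pos
  have hC₁0 : 0 ≤ C₁ := by positivity
  have hC₂0 : 0 ≤ C₂ := by positivity
  refine ⟨C₁ + C₂, searchAlgorithm IX IH, fun ε δ hε hε1 hδ hδ1 N x E hEx hη => ?_⟩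
  have hE := hEx.1
  -- the angle of the encoded vector
  have hη1 := BlockEncoding.efficiency_le_one hE
  set η := E.efficiency with hηdef
  set θ := Real.arcsin η with hθdef
  have hθ : Real.sin θ = η := Real.sin_arcsin (by linarith) hη1
  have hθ0 : 0 < θ := Real.arcsin_pos.2 hη
  have hθ2 : θ ≤ Real.pi / 2 := Real.arcsin_le_pi_div_two _
  have hηθ : η ≤ θ := hθ ▸ Real.sin_le hθ0.le
  have hinv : θ⁻¹ ≤ η⁻¹ := inv_anti₀ hη hηθ
  have hg1 : (1 : ℝ) ≤ E.gateCount := by exact_mod_cast E.gateCount_pos hE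
  set R : Set (Result 𝒢 E.signature) := {r | ∃ (V : QUnitary E.m)
    (hV : (E.outputImpl r).Implements V),
      (E.replace V (E.outputImpl r) hV r.γ).EncodesVector x ε ∧
      1 / 4 ≤ (E.replace V (E.outputImpl r) hV r.γ).efficiency ∧
      (r.executed : ℝ) ≤
        (C₁ + C₂) * (ε⁻¹ * η⁻¹ * max 1 (Real.logb 2 δ⁻¹) * E.gateCount) ∧
      ((E.replace V (E.outputImpl r) hV r.γ).gateCount : ℝ) ≤
        (C₁ + C₂) * (η⁻¹ * E.gateCount)} with hRdef
  have hR : ∀ (M j t : ℕ), 8 / ε ≤ j →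
      StageInvariant ε δ θ (stepCost IX IH * E.gateCount) M j t →
      (⟨t, workspace IX IH E.signature + 1, amplifyCircuit IX IH E.signature
        (SearchState.mk M j 0 0).steps, E.γ * (SearchState.mk M j 0 0).factor⟩ :
        Result 𝒢 E.signature) ∈ R := by
    intro M j t hj hI
    obtain ⟨o1, o2, o3, o4, o5⟩ := hI.localizes.output hθ0 hθ2 hε hε1 hj
    set σ := SearchState.mk M j 0 0 with hσ
    have himpl := (E.actsAs_amplifyCircuit hX hH σ.steps).implements
    refine ⟨E.amplify σ.steps, himpl, hEx.replace_amplify E hη hθ σ.steps _ himpl o3 o4 o5, ?_,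
      ?_, ?_⟩
    · exact (o2.trans (le_abs_self _)).trans_eq
        (E.efficiency_replace_amplify hE hθ σ.steps _ himpl _).symm
    · change (t : ℝ) ≤ _
      have h1 := hI.cost
      have h2 := logBudget_le_final hε hδ hδ1 hj
      have h3 : (M : ℝ) ≤ 100 * (ε⁻¹ * η⁻¹) := by
        have h4 := hI.bounded
        have h5 : (M : ℝ) ≤ 100 * (ε⁻¹ * θ⁻¹) := by
          rw [← mul_inv, ← div_eq_mul_inv, le_div_iff₀ (by positivity)]
          linarith
        exact h5.trans (by gcongr)
      have hm1 : 0 ≤ max 1 (Real.logb 2 δ⁻¹) := zero_le_one.trans (le_max_left _ _)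
      calc (t : ℝ) ≤ costConst * (M * (stepCost IX IH * E.gateCount)) * logBudget ε δ j := h1
        _ ≤ costConst * (M * (stepCost IX IH * E.gateCount)) *
            ((Real.log budgetConst + 1) * max 1 (Real.logb 2 δ⁻¹)) := by gcongr
        _ ≤ costConst * ((100 * (ε⁻¹ * η⁻¹)) * (stepCost IX IH * E.gateCount)) *
            ((Real.log budgetConst + 1) * max 1 (Real.logb 2 δ⁻¹)) := by gcongr
        _ = C₁ * (ε⁻¹ * η⁻¹ * max 1 (Real.logb 2 δ⁻¹) * E.gateCount) := by rw [hC₁]; ring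
        _ ≤ _ := by gcongr; linarith
    · have h1 := E.gateCount_replace_le _ _ himpl (E.γ * σ.factor)
      have h0 := h1.trans (Nat.add_le_add_right (E.length_amplifyCircuit_le IX IH hE σ.steps) _)
      refine (Nat.cast_le.2 h0).trans ?_
      push_cast
      have h2 : 2 * (σ.steps : ℝ) + 1 ≤ 2 * η⁻¹ := by
        have : 2 * (σ.steps : ℝ) + 1 ≤ 2 * θ⁻¹ := by
          rw [← div_eq_mul_inv, le_div_iff₀ hθ0]
          linarith [Real.pi_le_four]
        linarith
      have h3 : 1 ≤ η⁻¹ := (one_le_inv₀ hη).2 hη1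
      calc (2 * (σ.steps : ℝ) + 1) * (stepCost IX IH * E.gateCount) + E.gateCount
          ≤ 2 * η⁻¹ * (stepCost IX IH * E.gateCount) + η⁻¹ * E.gateCount := by
            gcongr
            exact le_mul_of_one_le_left (by positivity) h3
        _ = C₂ * (η⁻¹ * E.gateCount) := by rw [hC₂]; ring
        _ ≤ _ := by gcongr; linarith
  have hinit : StageInvariant ε δ θ (stepCost IX IH * E.gateCount) 1 0 0 := by
    have hL : 3 * Real.log 9 ≤ logBudget ε δ 0 :=
      three_log_le_logBudget hε hε1 hδ hδ1 (by push_cast; positivity)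
    have h9 := one_le_log_nine
    refine ⟨⟨odd_one, ?_, ?_⟩, ?_, ?_⟩
    · simpa using hθ0.le
    · simpa using hθ2
    · have : ε * θ ≤ 1 * θ := mul_le_mul_of_nonneg_right hε1 hθ0.le
      rw [Nat.cast_one, one_mul]
      linarith [Real.pi_le_four]
    · have : 0 ≤ logBudget ε δ 0 := by linarith
      rw [Nat.cast_zero]
      positivity
  have hmain := E.one_le_success_stage hX hH hE hθ hθ0 hε hε1 hδ hδ1 R hR _ [] 0 1 0 le_rfl rfl
    hinit
  have hprob : (searchAlgorithm IX IH ε δ N E.signature E.γ).prob E.subroutines R =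
      (searchAlgorithm IX IH ε δ N E.signature E.γ).success E.subroutines R (.running [] 0) := by
    simp only [Procedure.prob, Procedure.success, Procedure.successWithin,
      Procedure.exec_eq_execFrom]
  rw [hprob, ENNReal.ofReal_sub _ hδ.le, ENNReal.ofReal_one, tsub_le_iff_right]
  refine hmain.trans (add_le_add_right (ENNReal.ofReal_le_ofReal ?_) _)
  have : 0 ≤ ε * (((1 : ℕ) : ℝ) * θ) / 100 := by positivity
  nlinarith
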